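/- Let $q\ge 1$ and $c>0$. For $N\ge 1$ let $G(N,c)$ be the random directed multigraph on nodes $1,\dots,N$ with $\lfloor cN\rfloor$ edges, each an ordered pair of nodes chosen independently and uniformly among all $N^2$ ordered pairs. Let $J:\{0,\dots,q-1\}^2\to[0,\infty)$ be a deterministic edge potential, let $J_{\max}=\max_{i,j}J(i,j)$, and call a spin value $i$ soft if $J(i,j)>0$ and $J(j,i)>0$ for all $j$. Let the node potentials $h_u:\{0,\dots,q-1\}\to[0,\infty)$ be i.i.d. with a law $\nu_h$, independent of the graph, such that for some constants $\rho_{\max}\ge\rho_{\min}>0$, almost surely $$\rho_{\min}\le\sum_{i\text{ soft}}h_u(i)\quad\text{and}\quad\sum_{i}h_u(i)\le\rho_{\max}$$ (for instance, $h_u=h$ deterministic and strictly positive, when a soft spin value exists). Put $$Z(G(N,c))=\sum_{\sigma:\{1,\dots,N\}\to\{0,\dots,q-1\}}\ \prod_{u=1}^N h_u(\sigma(u))\prod_{(u,v)\in E(G(N,c))}J(\sigma(u),\sigma(v)),$$ where edges are counted with multiplicity. Theorem 2. Suppose that $\max_i\min_jJ(i,j)>0$ and that the $q\times q$ matrix $(\alpha-J(i,j))_{0\le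 i,j\le q-1}$ is (symmetric) positive semidefinite for some $\alpha\ge J_{\max}$. Then $G(N,c)$ is right-converging with respect to $\nu_h$ and $J$: there is a deterministic $z\in\mathbb R$ such that for every $\epsilon>0$ $$\lim_{N\to\infty}\mathbb P\left(\left|N^{-1}\log Z(G(N,c))-z\right|>\epsilon\right)=0,\qquad \log 0=-\infty.$$ In particular, for every $c>0$, $G(N,c)$ is right-converging for: the independent set model ($q=2$, $h(0)=1$, $h(1)=\lambda>0$, $J(1,1)=0$ and $J(i,j)=1$ otherwise); the anti-ferromagnetic Potts model ($q\ge1$, $h\equiv1$, $J(i,i)=e^{-\beta}$ and $J(i,j)=1$ for $i\ne j$, with $\beta>0$); and the anti-ferromagnetic Ising model ($q=2$, $h(0)=1$, $h(1)=h\ge0$, $J(i,i)=e^{\beta}$ and $J(i,j)=e^{-\beta}$ for $i\neq j$, with $\beta<0$). -/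

import Mathlib

open MeasureTheory Filter Topology

noncomputable section

/-- The partition function of a directed multigraph on the nodes `Fin N` with `M` ordered edges
`e 0, …, e (M - 1)` (loops and repetitions allowed), for spins in `Fin q`, node potentials `h u`
and one common edge potential `J`:
`Z = ∑ σ, ∏ u, h u (σ u) * ∏ m, J (σ (e m).1) (σ (e m).2)`. -/
def partitionFunction {q N M : ℕ} (J : Fin q → Fin q → ℝ) (e : Fin M → Fin N × Fin N)
    (h : Fin N → Fin q → ℝ) : ℝ :=
  ∑ σ : Fin N → Fin q, (∏ u, h u (σ u)) * ∏ m, J (σ (e m).1) (σ (e m).2)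

/-- The law of the sparse random graph `G(N,c)` together with its node potentials: `⌊c N⌋` ordered
pairs of nodes, each uniform among the `N ^ 2` ordered pairs, and `N` node potentials with
law `ν`, all of them independent. -/
def randomGraphLaw {q : ℕ} (c : ℝ) (ν : Measure (Fin q → ℝ)) (N : ℕ) :
    Measure ((Fin ⌊c * N⌋₊ → Fin N × Fin N) × (Fin N → Fin q → ℝ)) :=
  (Measure.pi fun _ => ProbabilityTheory.uniformOn (Set.univ : Set (Fin N × Fin N))).prod
    (Measure.pi fun _ => ν)

/-- Right-convergence of `G(N,c)` with respect to the law `ν` of the node potentials and the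
deterministic edge potential `J`: `N⁻¹ log Z(G(N,c))` converges in probability to a
deterministic real number `z`. Since `log 0` is `-∞`, the event `Z = 0` counts as a deviation. -/
def RightConverging {q : ℕ} (c : ℝ) (ν : Measure (Fin q → ℝ)) (J : Fin q → Fin q → ℝ) : Prop :=
  ∃ z : ℝ, ∀ ε : ℝ, 0 < ε →
    Tendsto (fun N : ℕ => randomGraphLaw c ν N
      {ω | partitionFunction J ω.1 ω.2 = 0 ∨
        ε < |(N : ℝ)⁻¹ * Real.log (partitionFunction J ω.1 ω.2) - z|}) atTop (𝓝 0)

/-- A soft state: a spin value with positive interaction with every spin value, whichever of the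
two ends of the edge it occupies. -/
def IsSoft {q : ℕ} (J : Fin q → Fin q → ℝ) (i : Fin q) : Prop :=
  ∀ j, 0 < J i j ∧ 0 < J j i

open Classical in
/-- The standing assumption on the law `ν` of the node potentials: almost surely the node potential
is nonnegative, its total mass is bounded above by a constant, and its mass on the soft states is
bounded below by a positive constant. -/
def NodeAssumption {q : ℕ} (ν : Measure (Fin q → ℝ)) (J : Fin q → Fin q → ℝ) : Prop :=
  ∃ ρmin ρmax : ℝ, 0 < ρmin ∧ ∀ᵐ h ∂ν,
    (∀ i, 0 ≤ h i) ∧ ρmin ≤ ∑ i with IsSoft J i, h i ∧ ∑ i, h i ≤ ρmax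

/-- Edge potential of the independent set (hard-core) model. -/
def hardCoreEdge (i j : Fin 2) : ℝ := if i = 1 ∧ j = 1 then 0 else 1

/-- Edge potential of the partial colorings (Potts) model with `q` colors. -/
def pottsEdge (q : ℕ) (β : ℝ) (i j : Fin q) : ℝ := if i = j then Real.exp (-β) else 1

/-- Edge potential of the Ising model. -/
def isingEdge (β : ℝ) (i j : Fin 2) : ℝ := if i = j then Real.exp β else Real.exp (-β)

end

/-! The mean of `log Z` is superadditive in the number of nodes up to a summable-scale error, which
gives convergence of its normalization; a variance bound of order `N` then gives convergence in
probability.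

Superadditivity is proved by interpolation. Split the nodes into two blocks and compare uniform
edges with edges confined to a randomly chosen block. For a Gibbs measure with weight `W`, let `X u
v` be the mean of `(α - J (σ u) (σ v)) / α`. It is a nonnegative mixture of submatrices of a
positive semidefinite matrix, hence positive semidefinite, and so are its entrywise powers, by
Schur. Adding the edge `(u, v)` changes `log Z` by `log α + log (1 - X u v)`, where `-log (1 - x) =
∑ x ^ k / k`. A positive semidefinite matrix has a larger mean over confined edges than over uniform
ones, so uniform edges give the larger mean of `log Z` (`sum_splitEdge_log_le`,
`meanLog_splitEdge_le`). With confined edges `Z` factorizes and the edge number of a block is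
binomial (`meanLog_splitEdge_eq`); replacing it by `⌊c n⌋` costs only the square root of the smaller
block size (`freeEnergy_superadditive`). A square-root correction absorbs this cost, and Fekete's
lemma applies (`exists_tendsto_meanFreeEnergy`).

All continuity estimates use soft spins: at the price of a factor exponential in the degree of a
node, its spin can be made soft, after which any change of the edges or the potential at that node
is harmless (`sum_le_sum_of_update_le`). Hence `log Z` changes by a constant times one plus a
degree. Degrees have bounded second moments, so the Efron-Stein inequality yields the variance bound
(`variance_log_graphSum_le`), and Chebyshev's inequality concludes. -/

noncomputable section

/-- Multiply a weight on spin configurations by the potential of one additional edge. -/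
def edgeTilt {q : ℕ} {V : Type*} (J : Fin q → Fin q → ℝ) (e : V × V) (W : (V → Fin q) → ℝ) :
    (V → Fin q) → ℝ := fun σ => W σ * J (σ e.1) (σ e.2)

/-- A nonnegative weight which is positive at some configuration of soft spins. -/
def PosWeight {q : ℕ} {V : Type*} (J : Fin q → Fin q → ℝ) (W : (V → Fin q) → ℝ) : Prop :=
  (∀ σ, 0 ≤ W σ) ∧ ∃ σ, (∀ u, IsSoft J (σ u)) ∧ 0 < W σ

/-- The mean of `log ∑ σ, W σ * ∏ m, J (σ (e m).1) (σ (e m).2)` over `M` independent edges `e m`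
of law `w`. -/
def meanLog {q : ℕ} {V : Type*} [Fintype V] [DecidableEq V] (J : Fin q → Fin q → ℝ)
    (w : V × V → ℝ) : ℕ → ((V → Fin q) → ℝ) → ℝ
  | 0, W => Real.log (∑ σ, W σ)
  | M + 1, W => ∑ e, w e * meanLog J w M (edgeTilt J e W)

/-- The uniform law on ordered pairs. -/
def unifEdge (V : Type*) [Fintype V] : V × V → ℝ := fun _ => 1 / (Fintype.card V : ℝ) ^ 2

/-- The law of an edge which is uniform inside one of the two blocks, the block being chosen with
probability proportional to its size. -/
def splitEdge (V₁ V₂ : Type*) [Fintype V₁] [Fintype V₂] : (V₁ ⊕ V₂) × (V₁ ⊕ V₂) → ℝ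
  | (.inl _, .inl _) => 1 / (((Fintype.card V₁ : ℝ) + Fintype.card V₂) * Fintype.card V₁)
  | (.inr _, .inr _) => 1 / (((Fintype.card V₁ : ℝ) + Fintype.card V₂) * Fintype.card V₂)
  | _ => 0

/-! ### Interpolation between uniform edges and edges inside two blocks. -/

section Interpolation

variable {q : ℕ} {J : Fin q → Fin q → ℝ} {α : ℝ}

/-- The same soft configuration remains a witness whatever edge is added, so every logarithm along
the interpolation is taken at a positive number. -/
lemma PosWeight.edgeTilt {V : Type*} {W : (V → Fin q) → ℝ} (hJ : ∀ i j, 0 ≤ J i j)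
    (hW : PosWeight J W) (e : V × V) : PosWeight J (edgeTilt J e W) := by
  obtain ⟨h0, σ, hσ, hpos⟩ := hW
  exact ⟨fun τ => mul_nonneg (h0 τ) (hJ _ _), σ, hσ, mul_pos hpos (hσ e.1 _).1⟩

lemma PosWeight.sum_pos {V : Type*} [Fintype V] [DecidableEq V] {W : (V → Fin q) → ℝ}
    (hW : PosWeight J W) : 0 < ∑ σ, W σ := by
  obtain ⟨h0, σ, -, hpos⟩ := hW
  exact Finset.sum_pos' (fun τ _ => h0 τ) ⟨σ, Finset.mem_univ _, hpos⟩

lemma edgeTilt_comm {V : Type*} (e e' : V × V) (W : (V → Fin q) → ℝ) :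
    edgeTilt J e (edgeTilt J e' W) = edgeTilt J e' (edgeTilt J e W) := by
  funext σ; simp only [edgeTilt]; ring

lemma sum_unifEdge (V : Type*) [Fintype V] [Nonempty V] : ∑ e, unifEdge V e = 1 := by
  have : (Fintype.card V : ℝ) ≠ 0 := by simp
  simp only [unifEdge, Finset.sum_const, Finset.card_univ, Fintype.card_prod, nsmul_eq_mul]
  push_cast; field_simp

lemma unifEdge_nonneg (V : Type*) [Fintype V] (e : V × V) : 0 ≤ unifEdge V e := by
  unfold unifEdge; positivity

lemma splitEdge_nonneg {V₁ V₂ : Type*} [Fintype V₁] [Fintype V₂] (e) :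
    0 ≤ splitEdge V₁ V₂ e := by
  rcases e with ⟨a | a, b | b⟩ <;> simp only [splitEdge] <;> positivity

lemma sum_splitEdge_mul {V₁ V₂ : Type*} [Fintype V₁] [Fintype V₂]
    (A : (V₁ ⊕ V₂) × (V₁ ⊕ V₂) → ℝ) :
    ∑ e, splitEdge V₁ V₂ e * A e =
      1 / (((Fintype.card V₁ : ℝ) + Fintype.card V₂) * Fintype.card V₁) *
        ∑ e : V₁ × V₁, A (.inl e.1, .inl e.2) +
      1 / (((Fintype.card V₁ : ℝ) + Fintype.card V₂) * Fintype.card V₂) *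
        ∑ e : V₂ × V₂, A (.inr e.1, .inr e.2) := by
  simp only [Fintype.sum_prod_type, Fintype.sum_sum_type, splitEdge, zero_mul,
    Finset.sum_const_zero, add_zero, zero_add, Finset.mul_sum]

lemma sum_splitEdge {V₁ V₂ : Type*} [Fintype V₁] [Fintype V₂] [Nonempty V₁] [Nonempty V₂] :
    ∑ e, splitEdge V₁ V₂ e = 1 := by
  have := sum_splitEdge_mul (V₁ := V₁) (V₂ := V₂) fun _ => 1
  simp only [mul_one] at this
  rw [this]
  have h1 : (0 : ℝ) < Fintype.card V₁ := by exact_mod_cast Fintype.card_pos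
  have h2 : (0 : ℝ) < Fintype.card V₂ := by exact_mod_cast Fintype.card_pos
  simp only [Finset.sum_const, Finset.card_univ, Fintype.card_prod, nsmul_eq_mul]
  push_cast; field_simp

lemma sum_unifEdge_le_sum_splitEdge {V₁ V₂ : Type*} [Fintype V₁] [Fintype V₂]
    [Nonempty V₁] [Nonempty V₂] {A : Matrix (V₁ ⊕ V₂) (V₁ ⊕ V₂) ℝ} (hA : A.PosSemidef) :
    ∑ e, unifEdge (V₁ ⊕ V₂) e * A e.1 e.2 ≤ ∑ e, splitEdge V₁ V₂ e * A e.1 e.2 := by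
  have h1 : (0 : ℝ) < Fintype.card V₁ := by exact_mod_cast Fintype.card_pos
  have h2 : (0 : ℝ) < Fintype.card V₂ := by exact_mod_cast Fintype.card_pos
  rw [sum_splitEdge_mul]
  -- The test vector is the difference of the uniform laws on the two blocks; up to the factor `n₁
  -- n₂ / (n₁ + n₂) ^ 2` its quadratic form is exactly the difference of the two means.
  have key := hA.dotProduct_mulVec_nonneg
    (Sum.elim (fun _ => 1 / (Fintype.card V₁ : ℝ)) (fun _ => -1 / (Fintype.card V₂ : ℝ)))
  simp only [dotProduct, Matrix.mulVec, Fintype.sum_sum_type, Sum.elim_inl, Sum.elim_inr,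
    Pi.star_apply, star_trivial] at key
  simp only [unifEdge, Fintype.sum_prod_type, Fintype.sum_sum_type, Fintype.card_sum,
    ← Finset.mul_sum]
  simp only [← Finset.mul_sum, ← Finset.sum_mul, mul_add, Finset.sum_add_distrib] at key ⊢
  push_cast
  set a : ℝ := (Fintype.card V₁ : ℝ)
  set b : ℝ := (Fintype.card V₂ : ℝ)
  set S11 := ∑ i : V₁, ∑ j : V₁, A (Sum.inl i) (Sum.inl j)
  set S12 := ∑ i : V₁, ∑ j : V₂, A (Sum.inl i) (Sum.inr j)
  set S21 := ∑ i : V₂, ∑ j : V₁, A (Sum.inr i) (Sum.inl j)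
  set S22 := ∑ i : V₂, ∑ j : V₂, A (Sum.inr i) (Sum.inr j)
  rw [← sub_nonneg]
  have : 1 / ((a + b) * a) * S11 + 1 / ((a + b) * b) * S22 -
      (1 / (a + b) ^ 2 * S11 + 1 / (a + b) ^ 2 * S12 +
        (1 / (a + b) ^ 2 * S21 + 1 / (a + b) ^ 2 * S22)) =
      a * b / (a + b) ^ 2 * (1 / a * (S11 * (1 / a)) + 1 / a * (S12 * (-1 / b)) +
        (-1 / b * (S21 * (1 / a)) + -1 / b * (S22 * (-1 / b)))) := by
    field_simp; ring
  rw [this]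
  exact mul_nonneg (by positivity) key

/-- The Schur product theorem, iterated. The exponents `k + 1` are those of the series of `-log (1 -
x)`. -/
lemma posSemidef_hadamard_pow {ι : Type*} [Finite ι] {A : Matrix ι ι ℝ} (hA : A.PosSemidef)
    (k : ℕ) : (Matrix.of fun i j => A i j ^ (k + 1)).PosSemidef := by
  induction k with
  | zero =>
    have h : (Matrix.of fun i j => A i j ^ (0 + 1)) = A := by ext i j; simp
    rwa [h]
  | succ k ih =>
    have h : (Matrix.of fun i j => A i j ^ (k + 1 + 1)) =
        (Matrix.of fun i j => A i j ^ (k + 1)).hadamard A := by ext i j; simp [pow_succ]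
    rw [h]
    exact ih.hadamard hA

/-- Adding a uniform edge increases the mean of `log Z` at least as much as adding an edge inside
one of the two blocks. -/
lemma sum_splitEdge_log_le {V₁ V₂ : Type*} [Fintype V₁] [Fintype V₂] [DecidableEq V₁]
    [DecidableEq V₂] [Nonempty V₁] [Nonempty V₂] (hα : 0 < α) (hJ : ∀ i j, 0 ≤ J i j)
    (hJα : ∀ i j, J i j ≤ α)
    (hpsd : (Matrix.of fun i j => α - J i j).PosSemidef) {W : (V₁ ⊕ V₂ → Fin q) → ℝ}
    (hW : PosWeight J W) :
    ∑ e, splitEdge V₁ V₂ e * Real.log (∑ σ, edgeTilt J e W σ) ≤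
      ∑ e, unifEdge (V₁ ⊕ V₂) e * Real.log (∑ σ, edgeTilt J e W σ) := by
  set T := ∑ σ, W σ with hT
  have hTpos : 0 < T := hW.sum_pos
  -- `X u v` is the Gibbs mean, under the normalized weight `W / T`, of `(α - J (σ u) (σ v)) / α`.
  set X : Matrix (V₁ ⊕ V₂) (V₁ ⊕ V₂) ℝ :=
    ∑ σ, (W σ / (T * α)) • (Matrix.of fun i j => α - J i j).submatrix σ σ with hX
  have hXpsd : X.PosSemidef :=
    Matrix.posSemidef_sum _ fun σ _ => (hpsd.submatrix σ).smul (div_nonneg (hW.1 σ) (by positivity))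
  have hXe : ∀ u v, X u v = ∑ σ, W σ / (T * α) * (α - J (σ u) (σ v)) := by
    intro u v
    simp [hX, Matrix.sum_apply]
  have hsum : ∀ e : (V₁ ⊕ V₂) × (V₁ ⊕ V₂),
      ∑ σ, edgeTilt J e W σ = T * α * (1 - X e.1 e.2) := by
    intro e
    have hTα : T * α = ∑ σ, W σ * α := by rw [hT, Finset.sum_mul]
    rw [hXe, mul_sub, mul_one, Finset.mul_sum]
    nth_rewrite 1 [hTα]
    rw [← Finset.sum_sub_distrib]
    refine Finset.sum_congr rfl fun σ _ => ?_
    unfold edgeTilt; field_simp; ring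
  have hX0 : ∀ u v, 0 ≤ X u v := fun u v => by
    rw [hXe]
    exact Finset.sum_nonneg fun σ _ => mul_nonneg (div_nonneg (hW.1 σ) (by positivity))
      (sub_nonneg.2 (hJα _ _))
  -- Strict because the tilted weight still has positive total mass; the logarithmic series
  -- therefore converges.
  have hX1 : ∀ u v, X u v < 1 := fun u v => by
    have := (hW.edgeTilt hJ (u, v)).sum_pos
    rw [hsum] at this
    have := pos_of_mul_pos_right this (by positivity)
    simpa using this
  have hlog : ∀ e : (V₁ ⊕ V₂) × (V₁ ⊕ V₂), Real.log (∑ σ, edgeTilt J e W σ) =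
      Real.log (T * α) + Real.log (1 - X e.1 e.2) := fun e => by
    rw [hsum, Real.log_mul (by positivity) (by linarith [hX1 e.1 e.2])]
  simp only [hlog, mul_add, Finset.sum_add_distrib, ← Finset.sum_mul, sum_unifEdge, sum_splitEdge]
  gcongr 1
  have hs : ∀ w : (V₁ ⊕ V₂) × (V₁ ⊕ V₂) → ℝ,
      HasSum (fun k : ℕ => ∑ e, w e * (X e.1 e.2 ^ (k + 1) / (k + 1)))
        (-∑ e, w e * Real.log (1 - X e.1 e.2)) := by
    intro w
    rw [← Finset.sum_neg_distrib]
    refine hasSum_sum fun e _ => ?_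
    rw [← mul_neg]
    exact (Real.hasSum_pow_div_log_of_abs_lt_one
      (by rw [abs_of_nonneg (hX0 _ _)]; exact hX1 _ _)).mul_left _
  -- Compare the two series term by term; the minus sign of `log (1 - x)` reverses the inequality
  -- between the means.
  refine neg_le_neg_iff.1 (hasSum_le (fun k => ?_) (hs (unifEdge _)) (hs (splitEdge _ _)))
  have := sum_unifEdge_le_sum_splitEdge (posSemidef_hadamard_pow hXpsd k)
  simp only [Matrix.of_apply] at this
  simp only [← mul_div_assoc, ← Finset.sum_div]
  gcongr

lemma sum_splitEdge_meanLog_le {V₁ V₂ : Type*} [Fintype V₁] [Fintype V₂] [DecidableEq V₁]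
    [DecidableEq V₂] [Nonempty V₁] [Nonempty V₂] (hα : 0 < α) (hJ : ∀ i j, 0 ≤ J i j)
    (hJα : ∀ i j, J i j ≤ α)
    (hpsd : (Matrix.of fun i j => α - J i j).PosSemidef) (M : ℕ)
    {W : (V₁ ⊕ V₂ → Fin q) → ℝ} (hW : PosWeight J W) :
    ∑ e, splitEdge V₁ V₂ e * meanLog J (unifEdge (V₁ ⊕ V₂)) M (edgeTilt J e W) ≤
      ∑ e, unifEdge (V₁ ⊕ V₂) e * meanLog J (unifEdge (V₁ ⊕ V₂)) M (edgeTilt J e W) := by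
  induction M generalizing W with
  | zero => exact sum_splitEdge_log_le hα hJ hJα hpsd hW
  | succ M ih =>
    -- Edges may be added in any order, so one of the uniform edges `e'` is brought outermost and
    -- absorbed into the weight before the induction hypothesis is used.
    simp only [meanLog, Finset.mul_sum]
    rw [Finset.sum_comm]
    conv_rhs => rw [Finset.sum_comm]
    refine Finset.sum_le_sum fun e' _ => ?_
    have := mul_le_mul_of_nonneg_left (ih (hW.edgeTilt hJ e')) (unifEdge_nonneg (V₁ ⊕ V₂) e')
    simp only [Finset.mul_sum] at this
    refine (Eq.le ?_).trans (this.trans (Eq.le ?_)) <;>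
      refine Finset.sum_congr rfl fun e _ => ?_ <;> rw [edgeTilt_comm e e'] <;> ring

/-- The interpolation inequality. -/
lemma meanLog_splitEdge_le {V₁ V₂ : Type*} [Fintype V₁] [Fintype V₂] [DecidableEq V₁]
    [DecidableEq V₂] [Nonempty V₁] [Nonempty V₂] (hα : 0 < α) (hJ : ∀ i j, 0 ≤ J i j)
    (hJα : ∀ i j, J i j ≤ α)
    (hpsd : (Matrix.of fun i j => α - J i j).PosSemidef) (M : ℕ)
    {W : (V₁ ⊕ V₂ → Fin q) → ℝ} (hW : PosWeight J W) :
    meanLog J (splitEdge V₁ V₂) M W ≤ meanLog J (unifEdge (V₁ ⊕ V₂)) M W := by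
  induction M generalizing W with
  | zero => exact le_rfl
  | succ M ih =>
    refine (Finset.sum_le_sum fun e _ => ?_).trans
      (sum_splitEdge_meanLog_le hα hJ hJα hpsd M hW)
    exact mul_le_mul_of_nonneg_left (ih (hW.edgeTilt hJ e)) (splitEdge_nonneg e)

end Interpolation

/-! ### Binomial edge counts and factorization over the blocks. -/

/-- The mean of `F K (M - K)` for `K` binomial with parameters `M` and `p`. -/
def binomMean (p : ℝ) : ℕ → (ℕ → ℕ → ℝ) → ℝ
  | 0, F => F 0 0
  | M + 1, F => p * binomMean p M (fun k l => F (k + 1) l) +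
      (1 - p) * binomMean p M (fun k l => F k (l + 1))

section Binomial

variable {p : ℝ}

lemma binomMean_add (M : ℕ) (F G : ℕ → ℕ → ℝ) :
    binomMean p M (fun k l => F k l + G k l) = binomMean p M F + binomMean p M G := by
  induction M generalizing F G with
  | zero => rfl
  | succ M ih => simp only [binomMean]; rw [ih, ih]; ring

lemma binomMean_const_mul (M : ℕ) (a : ℝ) (F : ℕ → ℕ → ℝ) :
    binomMean p M (fun k l => a * F k l) = a * binomMean p M F := by
  induction M generalizing F with
  | zero => rfl
  | succ M ih => simp only [binomMean]; rw [ih, ih]; ring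

lemma binomMean_sum {ι : Type*} (s : Finset ι) (M : ℕ) (F : ι → ℕ → ℕ → ℝ) :
    binomMean p M (fun k l => ∑ i ∈ s, F i k l) = ∑ i ∈ s, binomMean p M (F i) := by
  induction M generalizing F with
  | zero => rfl
  | succ M ih => simp only [binomMean]; rw [ih, ih]; simp [Finset.sum_add_distrib, Finset.mul_sum]

lemma binomMean_const (M : ℕ) (a : ℝ) : binomMean p M (fun _ _ => a) = a := by
  induction M with
  | zero => rfl
  | succ M ih => simp only [binomMean]; rw [ih]; ring

lemma binomMean_mono (hp : 0 ≤ p) (hp1 : p ≤ 1) (M : ℕ) {F G : ℕ → ℕ → ℝ}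
    (h : ∀ k l, F k l ≤ G k l) : binomMean p M F ≤ binomMean p M G := by
  induction M generalizing F G with
  | zero => exact h 0 0
  | succ M ih =>
    exact add_le_add (mul_le_mul_of_nonneg_left (ih fun k l => h _ _) hp)
      (mul_le_mul_of_nonneg_left (ih fun k l => h _ _) (sub_nonneg.2 hp1))

/-- Squared bias plus variance. The centre `x` must stay free, since a success in the first trial
shifts it by one. -/
lemma binomMean_sq_left (M : ℕ) (x : ℝ) :
    binomMean p M (fun k _ => ((k : ℝ) - x) ^ 2) = (M * p - x) ^ 2 + M * p * (1 - p) := by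
  induction M generalizing x with
  | zero => simp [binomMean]
  | succ M ih =>
    simp only [binomMean]
    have : (fun (k : ℕ) (_ : ℕ) => (((k + 1 : ℕ) : ℝ) - x) ^ 2) =
        fun (k : ℕ) (_ : ℕ) => ((k : ℝ) - (x - 1)) ^ 2 := by
      funext k l; push_cast; ring
    rw [this, ih, ih]; push_cast; ring

lemma binomMean_sq_right (M : ℕ) (x : ℝ) :
    binomMean p M (fun _ l => ((l : ℝ) - x) ^ 2) =
      (M * (1 - p) - x) ^ 2 + M * p * (1 - p) := by
  induction M generalizing x with
  | zero => simp [binomMean]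
  | succ M ih =>
    simp only [binomMean]
    have : (fun (_ : ℕ) (k : ℕ) => (((k + 1 : ℕ) : ℝ) - x) ^ 2) =
        fun (_ : ℕ) (k : ℕ) => ((k : ℝ) - (x - 1)) ^ 2 := by
      funext k l; push_cast; ring
    rw [this, ih, ih]; push_cast; ring

/-- With all edges inside the blocks the partition function factorizes. -/
lemma meanLog_splitEdge_eq {q : ℕ} {J : Fin q → Fin q → ℝ} {V₁ V₂ : Type*} [Fintype V₁]
    [Fintype V₂] [DecidableEq V₁] [DecidableEq V₂] [Nonempty V₁] [Nonempty V₂]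
    (hJ : ∀ i j, 0 ≤ J i j) (M : ℕ) {W₁ : (V₁ → Fin q) → ℝ} {W₂ : (V₂ → Fin q) → ℝ}
    (hW₁ : PosWeight J W₁) (hW₂ : PosWeight J W₂) :
    meanLog J (splitEdge V₁ V₂) M (fun σ => W₁ (fun u => σ (.inl u)) * W₂ (fun u => σ (.inr u))) =
      binomMean ((Fintype.card V₁ : ℝ) / (Fintype.card V₁ + Fintype.card V₂)) M
        (fun k l => meanLog J (unifEdge V₁) k W₁ + meanLog J (unifEdge V₂) l W₂) := by
  have h1 : (0 : ℝ) < Fintype.card V₁ := by exact_mod_cast Fintype.card_pos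
  have h2 : (0 : ℝ) < Fintype.card V₂ := by exact_mod_cast Fintype.card_pos
  induction M generalizing W₁ W₂ with
  | zero =>
    simp only [meanLog, binomMean]
    rw [← Real.log_mul hW₁.sum_pos.ne' hW₂.sum_pos.ne', Fintype.sum_mul_sum,
      ← Fintype.sum_prod_type']
    congr 1
    exact (Equiv.sumArrowEquivProdArrow V₁ V₂ (Fin q)).sum_comp
      (fun x : (V₁ → Fin q) × (V₂ → Fin q) => W₁ x.1 * W₂ x.2)
  | succ M ih =>
    rw [meanLog, sum_splitEdge_mul]
    have e1 : ∀ e : V₁ × V₁, edgeTilt J ((Sum.inl e.1, Sum.inl e.2) : (V₁ ⊕ V₂) × (V₁ ⊕ V₂))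
        (fun σ => W₁ (fun u => σ (.inl u)) * W₂ (fun u => σ (.inr u))) =
        fun σ => edgeTilt J e W₁ (fun u => σ (.inl u)) * W₂ (fun u => σ (.inr u)) := by
      intro e; funext σ; simp only [edgeTilt]; ring
    have e2 : ∀ e : V₂ × V₂, edgeTilt J ((Sum.inr e.1, Sum.inr e.2) : (V₁ ⊕ V₂) × (V₁ ⊕ V₂))
        (fun σ => W₁ (fun u => σ (.inl u)) * W₂ (fun u => σ (.inr u))) =
        fun σ => W₁ (fun u => σ (.inl u)) * edgeTilt J e W₂ (fun u => σ (.inr u)) := by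
      intro e; funext σ; simp only [edgeTilt]; ring
    simp only [e1, e2]
    rw [Finset.sum_congr rfl fun e _ => ih (hW₁.edgeTilt hJ e) hW₂,
      Finset.sum_congr rfl fun e _ => ih hW₁ (hW₂.edgeTilt hJ e), ← binomMean_sum,
      ← binomMean_sum, binomMean]
    congr 1
    -- The weight `1 / ((n₁ + n₂) n₁)` of an edge in the first block is `p / n₁ ^ 2`: a success of
    -- the binomial trial, followed by a uniform edge of that block.
    · have : ∀ k l, meanLog J (unifEdge V₁) (k + 1) W₁ + meanLog J (unifEdge V₂) l W₂ =
          1 / (Fintype.card V₁ : ℝ) ^ 2 * ∑ e : V₁ × V₁,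
            (meanLog J (unifEdge V₁) k (edgeTilt J e W₁) + meanLog J (unifEdge V₂) l W₂) := by
        intro k l
        simp only [meanLog, Finset.sum_add_distrib, mul_add, Finset.sum_const, Finset.card_univ,
          Fintype.card_prod, nsmul_eq_mul]
        congr 1
        · rw [Finset.mul_sum]; rfl
        · push_cast; field_simp
      simp only [this]
      rw [binomMean_const_mul, ← mul_assoc]
      congr 1; field_simp
    · have : ∀ k l, meanLog J (unifEdge V₁) k W₁ + meanLog J (unifEdge V₂) (l + 1) W₂ =
          1 / (Fintype.card V₂ : ℝ) ^ 2 * ∑ e : V₂ × V₂,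
            (meanLog J (unifEdge V₁) k W₁ + meanLog J (unifEdge V₂) l (edgeTilt J e W₂)) := by
        intro k l
        simp only [meanLog, Finset.sum_add_distrib, mul_add, Finset.sum_const, Finset.card_univ,
          Fintype.card_prod, nsmul_eq_mul]
        congr 1
        · push_cast; field_simp
        · rw [Finset.mul_sum]; rfl
      simp only [this]
      rw [binomMean_const_mul, ← mul_assoc]
      congr 1; field_simp; ring

end Binomial

/-! ### Effect on `log Z` of a change at a single node. -/

/-- The partition function on an arbitrary finite set of nodes. -/
def graphSum {q M : ℕ} {V : Type*} [Fintype V] [DecidableEq V] (J : Fin q → Fin q → ℝ)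
    (e : Fin M → V × V) (h : V → Fin q → ℝ) : ℝ :=
  ∑ σ : V → Fin q, (∏ u, h u (σ u)) * ∏ m, J (σ (e m).1) (σ (e m).2)

/-- The number of edges incident to a node. -/
def incidence {M : ℕ} {V : Type*} [DecidableEq V] (e : Fin M → V × V) (u : V) : ℕ :=
  (Finset.univ.filter fun k => (e k).1 = u ∨ (e k).2 = u).card

open Classical in
/-- Nonnegative node potentials with total mass at most `b` and soft mass at least `a`. -/
def GoodPot {q : ℕ} (J : Fin q → Fin q → ℝ) (a b : ℝ) (h : Fin q → ℝ) : Prop :=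
  (∀ i, 0 ≤ h i) ∧ a ≤ ∑ i with IsSoft J i, h i ∧ ∑ i, h i ≤ b

/-- Quantitative hypotheses on the edge potential: it takes values in `[0, α]`, and is at least
`δ` whenever one of the two spins is soft. -/
structure EdgeBounds {q : ℕ} (J : Fin q → Fin q → ℝ) (δ α : ℝ) : Prop where
  pos : 0 < δ
  le : δ ≤ α
  nonneg : ∀ i j, 0 ≤ J i j
  le_max : ∀ i j, J i j ≤ α
  soft_left : ∀ i j, IsSoft J i → δ ≤ J i j
  soft_right : ∀ i j, IsSoft J i → δ ≤ J j i

section SingleSite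

variable {q : ℕ} {J : Fin q → Fin q → ℝ} {a b δ α : ℝ} {V : Type*}

lemma GoodPot.exists_soft {h : Fin q → ℝ} (ha : 0 < a) (hh : GoodPot J a b h) :
    ∃ i, IsSoft J i ∧ 0 < h i := by
  classical
  by_contra hcon
  push Not at hcon
  have := hh.2.1
  have h0 : ∑ i with IsSoft J i, h i ≤ 0 :=
    Finset.sum_nonpos fun i hi => hcon i (Finset.mem_filter.1 hi).2
  linarith

lemma GoodPot.lower_le_upper {h : Fin q → ℝ} (hh : GoodPot J a b h) : a ≤ b := by
  classical
  refine hh.2.1.trans (le_trans ?_ hh.2.2)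
  exact Finset.sum_le_sum_of_subset_of_nonneg (Finset.filter_subset _ _) fun i _ _ => hh.1 i

lemma sum_sum_update [Fintype V] [DecidableEq V] (u : V) (G : (V → Fin q) → ℝ) :
    ∑ σ : V → Fin q, ∑ i, G (Function.update σ u i) = q * ∑ σ, G σ := by
  -- Exchanging the spin at `u` with the spare value `i` is an involution.
  let T : (V → Fin q) × Fin q ≃ (V → Fin q) × Fin q :=
    Function.Involutive.toPerm (fun x => (Function.update x.1 u x.2, x.1 u)) (by
      rintro ⟨σ, i⟩; simp)
  have h1 : ∑ x : (V → Fin q) × Fin q, G (T x).1 = ∑ x : (V → Fin q) × Fin q, G x.1 :=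
    T.sum_comp fun x => G x.1
  rw [Fintype.sum_prod_type, Fintype.sum_prod_type] at h1
  rw [Finset.mul_sum]
  simpa using! h1

/-- The basic comparison of two systems differing only at `u`. Here `X` and `X'` are the edge
factors, `f` and `f'` the potentials at `u`, and `R` the other potentials. With the other spins
frozen, all mass of the first system at `u` is charged to soft spins in the second, whose mass is at
least `a` against at most `b`. -/
lemma sum_le_sum_of_update_le [Fintype V] [DecidableEq V] (ha : 0 < a) (u : V)
    {X X' R : (V → Fin q) → ℝ} {f f' : Fin q → ℝ} {lam : ℝ} (hf : GoodPot J a b f)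
    (hf' : GoodPot J a b f') (hlam : 0 ≤ lam) (hX : ∀ σ, 0 ≤ X σ) (hX' : ∀ σ, 0 ≤ X' σ)
    (hR : ∀ σ, 0 ≤ R σ) (hRu : ∀ σ i, R (Function.update σ u i) = R σ)
    (hXX' : ∀ σ s i, IsSoft J s →
      lam * X (Function.update σ u i) ≤ X' (Function.update σ u s)) :
    lam * (a / b) * ∑ σ, f (σ u) * R σ * X σ ≤ ∑ σ, f' (σ u) * R σ * X' σ := by
  classical
  have hb : 0 < b := ha.trans_le hf.lower_le_upper
  obtain ⟨s0, hs0, -⟩ := hf.exists_soft ha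
  have hq : (0 : ℝ) < q := by exact_mod_cast s0.pos
  refine le_of_mul_le_mul_left ?_ hq
  rw [← sum_sum_update u (fun σ => f' (σ u) * R σ * X' σ), mul_left_comm,
    ← sum_sum_update u (fun σ => f (σ u) * R σ * X σ), Finset.mul_sum]
  refine Finset.sum_le_sum fun σ _ => ?_
  simp only [Function.update_self, hRu]
  have e1 : ∀ (g : Fin q → ℝ) (Y : (V → Fin q) → ℝ), ∑ i, g i * R σ * Y (Function.update σ u i) =
      R σ * ∑ i, g i * Y (Function.update σ u i) := by
    intro g Y
    rw [Finset.mul_sum]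
    exact Finset.sum_congr rfl fun i _ => by ring
  rw [e1, e1, mul_left_comm]
  refine mul_le_mul_of_nonneg_left ?_ (hR σ)
  set A := ∑ i, f i * X (Function.update σ u i) with hA
  set B := ∑ i, f' i * X' (Function.update σ u i) with hB
  have hA0 : 0 ≤ A := Finset.sum_nonneg fun i _ => mul_nonneg (hf.1 i) (hX _)
  have key : lam * A * a ≤ b * B := by
    calc lam * A * a ≤ lam * A * ∑ s with IsSoft J s, f' s :=
          mul_le_mul_of_nonneg_left hf'.2.1 (mul_nonneg hlam hA0)
      _ = ∑ i, ∑ s with IsSoft J s, f i * (f' s * (lam * X (Function.update σ u i))) := by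
          rw [mul_comm lam, hA, Finset.sum_mul, Finset.sum_mul_sum]
          exact Finset.sum_congr rfl fun i _ => Finset.sum_congr rfl fun s _ => by ring
      _ ≤ ∑ i, ∑ s with IsSoft J s, f i * (f' s * X' (Function.update σ u s)) := by
          refine Finset.sum_le_sum fun i _ => Finset.sum_le_sum fun s hs => ?_
          exact mul_le_mul_of_nonneg_left (mul_le_mul_of_nonneg_left
            (hXX' σ s i (Finset.mem_filter.1 hs).2) (hf'.1 s)) (hf.1 i)
      _ = (∑ i, f i) * ∑ s with IsSoft J s, f' s * X' (Function.update σ u s) := by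
          rw [Finset.sum_mul_sum]
      _ ≤ (∑ i, f i) * B := by
          refine mul_le_mul_of_nonneg_left ?_ (Finset.sum_nonneg fun i _ => hf.1 i)
          exact Finset.sum_le_sum_of_subset_of_nonneg (Finset.filter_subset _ _)
            fun i _ _ => mul_nonneg (hf'.1 i) (hX' _)
      _ ≤ b * B := mul_le_mul_of_nonneg_right hf.2.2
          (Finset.sum_nonneg fun i _ => mul_nonneg (hf'.1 i) (hX' _))
  rw [mul_div_assoc', div_mul_eq_mul_div, div_le_iff₀ hb]
  linarith

lemma EdgeBounds.ratio_pos (hJ : EdgeBounds J δ α) : 0 < δ / α :=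
  div_pos hJ.pos (hJ.pos.trans_le hJ.le)

lemma EdgeBounds.max_pos (hJ : EdgeBounds J δ α) : 0 < α := hJ.pos.trans_le hJ.le

lemma EdgeBounds.ratio_mul_le (hJ : EdgeBounds J δ α) (i j : Fin q) : δ / α * J i j ≤ δ := by
  rw [div_mul_eq_mul_div, div_le_iff₀ hJ.max_pos]
  exact mul_le_mul_of_nonneg_left (hJ.le_max i j) hJ.pos.le

/-- Edges of `e'` touching `u` have value at least `δ` once the spin at `u` is soft, which is `δ /
α` times anything; all other edges coincide with those of `e` and do not see the spin at `u`. -/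
lemma prod_edges_update_le [DecidableEq V] (hJ : EdgeBounds J δ α) {M : ℕ} (u : V)
    {e e' : Fin M → V × V} (hee' : ∀ k, ((e' k).1 = u ∨ (e' k).2 = u) ∨ e' k = e k)
    (σ : V → Fin q) (s i : Fin q) (hs : IsSoft J s) :
    (δ / α) ^ incidence e' u * ∏ k, J (Function.update σ u i (e k).1)
        (Function.update σ u i (e k).2) ≤
      ∏ k, J (Function.update σ u s (e' k).1) (Function.update σ u s (e' k).2) := by
  have h1 : (δ / α) ^ incidence e' u =
      ∏ k, if (e' k).1 = u ∨ (e' k).2 = u then δ / α else 1 := by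
    rw [Finset.prod_ite, Finset.prod_const, Finset.prod_const_one, mul_one, incidence]
  rw [h1, ← Finset.prod_mul_distrib]
  refine Finset.prod_le_prod (fun k _ => mul_nonneg ?_ (hJ.nonneg _ _)) fun k _ => ?_
  · split_ifs
    exacts [hJ.ratio_pos.le, zero_le_one]
  · by_cases hk : (e' k).1 = u ∨ (e' k).2 = u
    · rw [if_pos hk]
      refine (hJ.ratio_mul_le _ _).trans ?_
      rcases hk with hk | hk
      · rw [hk, Function.update_self]; exact hJ.soft_left _ _ hs
      · rw [hk, Function.update_self]; exact hJ.soft_right _ _ hs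
    · rw [if_neg hk, one_mul]
      have h2 := (hee' k).resolve_left hk
      push Not at hk
      rw [h2] at hk ⊢
      rw [Function.update_of_ne hk.1, Function.update_of_ne hk.2, Function.update_of_ne hk.1,
        Function.update_of_ne hk.2]

variable [Fintype V] [DecidableEq V]

lemma graphSum_eq {M : ℕ} (e : Fin M → V × V) (h : V → Fin q → ℝ) (u : V) :
    graphSum J e h = ∑ σ : V → Fin q, h u (σ u) * (∏ w ∈ Finset.univ.erase u, h w (σ w)) *
      ∏ m, J (σ (e m).1) (σ (e m).2) := by
  unfold graphSum
  refine Finset.sum_congr rfl fun σ _ => ?_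
  rw [Finset.mul_prod_erase _ (fun w => h w (σ w)) (Finset.mem_univ u)]

lemma prod_erase_update (h : V → Fin q → ℝ) (u : V) (σ : V → Fin q) (i : Fin q) :
    ∏ w ∈ Finset.univ.erase u, h w (Function.update σ u i w) =
      ∏ w ∈ Finset.univ.erase u, h w (σ w) :=
  Finset.prod_congr rfl fun w hw => by rw [Function.update_of_ne (Finset.ne_of_mem_erase hw)]

lemma graphSum_change_edge (hJ : EdgeBounds J δ α) (ha : 0 < a) {h : V → Fin q → ℝ}
    (hh : ∀ u, GoodPot J a b (h u)) {M : ℕ} {e e' : Fin M → V × V} (u : V)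
    (hee' : ∀ k, ((e' k).1 = u ∨ (e' k).2 = u) ∨ e' k = e k) :
    (δ / α) ^ incidence e' u * (a / b) * graphSum J e h ≤ graphSum J e' h := by
  rw [graphSum_eq e h u, graphSum_eq e' h u]
  exact sum_le_sum_of_update_le (J := J) ha u (hh u) (hh u) (pow_nonneg hJ.ratio_pos.le _)
    (fun σ => Finset.prod_nonneg fun k _ => hJ.nonneg _ _)
    (fun σ => Finset.prod_nonneg fun k _ => hJ.nonneg _ _)
    (fun σ => Finset.prod_nonneg fun w _ => (hh w).1 _)
    (fun σ i => prod_erase_update h u σ i)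
    (fun σ s i hs => prod_edges_update_le hJ u hee' σ s i hs)

lemma graphSum_change_node (hJ : EdgeBounds J δ α) (ha : 0 < a) {h h' : V → Fin q → ℝ}
    (hh : ∀ u, GoodPot J a b (h u)) (u : V) (hh' : GoodPot J a b (h' u))
    (hne : ∀ w, w ≠ u → h' w = h w) {M : ℕ} (e : Fin M → V × V) :
    (δ / α) ^ incidence e u * (a / b) * graphSum J e h ≤ graphSum J e h' := by
  rw [graphSum_eq e h u, graphSum_eq e h' u]
  have : ∀ σ : V → Fin q, ∏ w ∈ Finset.univ.erase u, h' w (σ w) =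
      ∏ w ∈ Finset.univ.erase u, h w (σ w) := fun σ =>
    Finset.prod_congr rfl fun w hw => by rw [hne w (Finset.ne_of_mem_erase hw)]
  simp only [this]
  exact sum_le_sum_of_update_le (J := J) ha u (hh u) hh' (pow_nonneg hJ.ratio_pos.le _)
    (fun σ => Finset.prod_nonneg fun k _ => hJ.nonneg _ _)
    (fun σ => Finset.prod_nonneg fun k _ => hJ.nonneg _ _)
    (fun σ => Finset.prod_nonneg fun w _ => (hh w).1 _)
    (fun σ i => prod_erase_update h u σ i)
    (fun σ s i hs => prod_edges_update_le hJ u (fun k => Or.inr rfl) σ s i hs)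

lemma graphSum_cons {M : ℕ} (y : V × V) (e : Fin M → V × V) (h : V → Fin q → ℝ) :
    graphSum J (Fin.cons y e : Fin (M + 1) → V × V) h = ∑ σ : V → Fin q,
      (∏ u, h u (σ u)) * (J (σ y.1) (σ y.2) * ∏ m, J (σ (e m).1) (σ (e m).2)) := by
  unfold graphSum
  refine Finset.sum_congr rfl fun σ _ => ?_
  rw [Fin.prod_univ_succ]; simp

lemma graphSum_cons_le (hJ : EdgeBounds J δ α) {h : V → Fin q → ℝ} (hh : ∀ u i, 0 ≤ h u i)
    {M : ℕ} (y : V × V) (e : Fin M → V × V) :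
    graphSum J (Fin.cons y e : Fin (M + 1) → V × V) h ≤ α * graphSum J e h := by
  rw [graphSum_cons, graphSum, Finset.mul_sum]
  refine Finset.sum_le_sum fun σ _ => ?_
  rw [mul_left_comm α]
  refine mul_le_mul_of_nonneg_left ?_ (Finset.prod_nonneg fun u _ => hh _ _)
  exact mul_le_mul_of_nonneg_right (hJ.le_max _ _) (Finset.prod_nonneg fun u _ => hJ.nonneg _ _)

/-- Make the spin at the endpoint `y.1` soft: the old edges at that node cost `δ / α` each, and the
new edge contributes at least `δ`. -/
lemma le_graphSum_cons (hJ : EdgeBounds J δ α) (ha : 0 < a) {h : V → Fin q → ℝ}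
    (hh : ∀ u, GoodPot J a b (h u)) {M : ℕ} (y : V × V) (e : Fin M → V × V) :
    δ * (δ / α) ^ incidence e y.1 * (a / b) * graphSum J e h ≤
      graphSum J (Fin.cons y e : Fin (M + 1) → V × V) h := by
  rw [graphSum_eq e h y.1, graphSum_cons]
  have h1 : ∀ σ : V → Fin q, (∏ u, h u (σ u)) * (J (σ y.1) (σ y.2) *
      ∏ m, J (σ (e m).1) (σ (e m).2)) = h y.1 (σ y.1) *
      (∏ w ∈ Finset.univ.erase y.1, h w (σ w)) *
      (J (σ y.1) (σ y.2) * ∏ m, J (σ (e m).1) (σ (e m).2)) := fun σ => by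
    rw [Finset.mul_prod_erase _ (fun w => h w (σ w)) (Finset.mem_univ y.1)]
  simp only [h1]
  refine sum_le_sum_of_update_le (J := J) ha y.1 (hh y.1) (hh y.1)
    (mul_nonneg hJ.pos.le (pow_nonneg hJ.ratio_pos.le _))
    (fun σ => Finset.prod_nonneg fun k _ => hJ.nonneg _ _)
    (fun σ => mul_nonneg (hJ.nonneg _ _) (Finset.prod_nonneg fun k _ => hJ.nonneg _ _))
    (fun σ => Finset.prod_nonneg fun w _ => (hh w).1 _)
    (fun σ i => prod_erase_update h y.1 σ i) fun σ s i hs => ?_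
  rw [mul_assoc]
  refine mul_le_mul ?_ (prod_edges_update_le hJ y.1 (fun k => Or.inr rfl) σ s i hs)
    (mul_nonneg (pow_nonneg hJ.ratio_pos.le _) (Finset.prod_nonneg fun k _ => hJ.nonneg _ _))
    (hJ.nonneg _ _)
  rw [Function.update_self]
  exact hJ.soft_left _ _ hs

omit [DecidableEq V] in
lemma posWeight_prod (ha : 0 < a) {h : V → Fin q → ℝ} (hh : ∀ u, GoodPot J a b (h u)) :
    PosWeight J fun σ : V → Fin q => ∏ u, h u (σ u) := by
  choose s hs hpos using fun u => (hh u).exists_soft ha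
  exact ⟨fun σ => Finset.prod_nonneg fun u _ => (hh u).1 _, s, hs,
    Finset.prod_pos fun u _ => hpos u⟩

lemma graphSum_pos (hJ : EdgeBounds J δ α) (ha : 0 < a) {h : V → Fin q → ℝ}
    (hh : ∀ u, GoodPot J a b (h u)) {M : ℕ} (e : Fin M → V × V) : 0 < graphSum J e h := by
  obtain ⟨h0, σ, hσ, hpos⟩ := posWeight_prod ha hh
  exact Finset.sum_pos' (fun τ _ => mul_nonneg (h0 τ) (Finset.prod_nonneg fun k _ =>
    hJ.nonneg _ _)) ⟨σ, Finset.mem_univ _, mul_pos hpos (Finset.prod_pos fun k _ => (hσ _ _).1)⟩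

/-- The Lipschitz constant of `log Z` per unit of degree. -/
def lipConst (a b δ α : ℝ) : ℝ :=
  |Real.log δ| + |Real.log α| + Real.log (b / a) + Real.log (α / δ)

lemma lipConst_spec (hJ : EdgeBounds J δ α) (ha : 0 < a) (hab : a ≤ b) :
    0 ≤ lipConst a b δ α ∧ Real.log α ≤ lipConst a b δ α ∧
    (∀ d : ℕ, -(lipConst a b δ α * (1 + d)) ≤ Real.log ((δ / α) ^ d * (a / b))) ∧
    (∀ d : ℕ, -(lipConst a b δ α * (1 + d)) ≤ Real.log (δ * (δ / α) ^ d * (a / b))) := by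
  have hα := hJ.max_pos
  have hδ := hJ.pos
  have hb := ha.trans_le hab
  have h1 : 0 ≤ Real.log (b / a) := Real.log_nonneg ((one_le_div ha).2 hab)
  have h2 : 0 ≤ Real.log (α / δ) := Real.log_nonneg ((one_le_div hδ).2 hJ.le)
  have h3 : Real.log (a / b) = -Real.log (b / a) := by rw [← Real.log_inv, inv_div]
  have h4 : Real.log (δ / α) = -Real.log (α / δ) := by rw [← Real.log_inv, inv_div]
  have h5 := abs_nonneg (Real.log δ)
  have h6 := abs_nonneg (Real.log α)
  have h7 := neg_abs_le (Real.log δ)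
  have h8 := le_abs_self (Real.log α)
  refine ⟨by unfold lipConst; positivity, by unfold lipConst; linarith, fun d => ?_, fun d => ?_⟩
  · rw [Real.log_mul (by positivity) (by positivity), Real.log_pow, h3, h4]
    unfold lipConst
    have hd : (0 : ℝ) ≤ d := by positivity
    nlinarith [mul_nonneg hd h5, mul_nonneg hd h6, mul_nonneg hd h1]
  · rw [Real.log_mul (by positivity) (by positivity), Real.log_mul (by positivity) (by positivity),
      Real.log_pow, h3, h4]
    unfold lipConst
    have hd : (0 : ℝ) ≤ d := by positivity
    nlinarith [mul_nonneg hd h5, mul_nonneg hd h6, mul_nonneg hd h1]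

lemma log_sub_le_of_mul_le {x y r C : ℝ} (hr : 0 < r) (hx : 0 < x) (h : r * x ≤ y)
    (hC : -C ≤ Real.log r) : Real.log x - C ≤ Real.log y := by
  have := Real.log_le_log (mul_pos hr hx) h
  rw [Real.log_mul hr.ne' hx.ne'] at this
  linarith

omit [Fintype V] in
lemma incidence_update_le {M : ℕ} (x : Fin M → V × V) (m : Fin M) (y : V × V) (u : V) :
    incidence (Function.update x m y) u ≤ incidence x u + 1 := by
  unfold incidence
  refine (Finset.card_le_card ?_).trans (Finset.card_insert_le m _)
  intro k hk
  by_cases hkm : k = m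
  · simp [hkm]
  · simpa [hkm] using hk

/-- The bound is one-sided, with the degree of an endpoint of the incoming edge `y'`. The constant
is `2` because that edge may itself add one to the degree in `x`. -/
lemma log_graphSum_change_edge (hJ : EdgeBounds J δ α) (ha : 0 < a) (hab : a ≤ b)
    {h : V → Fin q → ℝ} (hh : ∀ u, GoodPot J a b (h u)) {M : ℕ} (x : Fin M → V × V) (m : Fin M)
    (y y' : V × V) :
    Real.log (graphSum J (Function.update x m y) h) -
      lipConst a b δ α * (2 + incidence x y'.1) ≤
      Real.log (graphSum J (Function.update x m y') h) := by
  have hb := ha.trans_le hab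
  have hC := lipConst_spec hJ ha hab
  have h1 := graphSum_change_edge hJ ha hh (e := Function.update x m y)
    (e' := Function.update x m y') y'.1 fun k => by
      by_cases hk : k = m
      · simp [hk]
      · simp [hk]
  have h2 := log_sub_le_of_mul_le (mul_pos (pow_pos hJ.ratio_pos _) (div_pos ha hb))
    (graphSum_pos hJ ha hh _) h1 (hC.2.2.1 _)
  refine le_trans ?_ h2
  have h3 : (incidence (Function.update x m y') y'.1 : ℝ) ≤ incidence x y'.1 + 1 := by
    exact_mod_cast incidence_update_le x m y' y'.1
  nlinarith [hC.1]

lemma log_graphSum_change_node (hJ : EdgeBounds J δ α) (ha : 0 < a) (hab : a ≤ b)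
    {h h' : V → Fin q → ℝ} (hh : ∀ u, GoodPot J a b (h u)) (u : V) (hh' : GoodPot J a b (h' u))
    (hne : ∀ w, w ≠ u → h' w = h w) {M : ℕ} (e : Fin M → V × V) :
    Real.log (graphSum J e h) - lipConst a b δ α * (1 + incidence e u) ≤
      Real.log (graphSum J e h') :=
  log_sub_le_of_mul_le (mul_pos (pow_pos hJ.ratio_pos _) (div_pos ha (ha.trans_le hab)))
    (graphSum_pos hJ ha hh _) (graphSum_change_node hJ ha hh u hh' hne e)
    ((lipConst_spec hJ ha hab).2.2.1 _)

lemma log_graphSum_cons_ge (hJ : EdgeBounds J δ α) (ha : 0 < a) (hab : a ≤ b)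
    {h : V → Fin q → ℝ} (hh : ∀ u, GoodPot J a b (h u)) {M : ℕ} (y : V × V) (e : Fin M → V × V) :
    Real.log (graphSum J e h) - lipConst a b δ α * (1 + incidence e y.1) ≤
      Real.log (graphSum J (Fin.cons y e : Fin (M + 1) → V × V) h) :=
  log_sub_le_of_mul_le (mul_pos (mul_pos hJ.pos (pow_pos hJ.ratio_pos _))
    (div_pos ha (ha.trans_le hab))) (graphSum_pos hJ ha hh _) (le_graphSum_cons hJ ha hh y e)
    ((lipConst_spec hJ ha hab).2.2.2 _)

lemma log_graphSum_cons_le (hJ : EdgeBounds J δ α) (ha : 0 < a) (hab : a ≤ b)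
    {h : V → Fin q → ℝ} (hh : ∀ u, GoodPot J a b (h u)) {M : ℕ} (y : V × V) (e : Fin M → V × V) :
    Real.log (graphSum J (Fin.cons y e : Fin (M + 1) → V × V) h) ≤
      Real.log (graphSum J e h) + lipConst a b δ α := by
  have h1 := Real.log_le_log (graphSum_pos hJ ha hh _)
    (graphSum_cons_le hJ (fun u => (hh u).1) y e)
  rw [Real.log_mul hJ.max_pos.ne' (graphSum_pos hJ ha hh _).ne'] at h1
  linarith [(lipConst_spec hJ ha hab).2.1]

omit [Fintype V] in
lemma incidence_eq_sum {M : ℕ} (e : Fin M → V × V) (u : V) :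
    (incidence e u : ℝ) = ∑ k, if (e k).1 = u ∨ (e k).2 = u then (1 : ℝ) else 0 := by
  simp [incidence]

lemma sum_incidence_le {M : ℕ} (e : Fin M → V × V) :
    ∑ u, (incidence e u : ℝ) ≤ 2 * M := by
  simp only [incidence_eq_sum]
  rw [Finset.sum_comm]
  have : ∀ k : Fin M, ∑ u, (if (e k).1 = u ∨ (e k).2 = u then (1 : ℝ) else 0) ≤ 2 := by
    intro k
    calc _ ≤ ∑ u, ((if (e k).1 = u then (1 : ℝ) else 0) + if (e k).2 = u then 1 else 0) := by
          refine Finset.sum_le_sum fun u _ => ?_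
          by_cases h1 : (e k).1 = u <;> by_cases h2 : (e k).2 = u <;> simp [h1, h2]
      _ = 2 := by rw [Finset.sum_add_distrib]; simp; norm_num
  refine (Finset.sum_le_sum fun k _ => this k).trans ?_
  simp [mul_comm]

end SingleSite

/-! ### Averages over uniform edges and the free energy as a function of the edge number. -/

/-- The mean of a function of `M` independent uniform edges. -/
def edgeMean (V : Type*) [Fintype V] [DecidableEq V] (M : ℕ) (F : (Fin M → V × V) → ℝ) : ℝ :=
  (∑ e, F e) / ((Fintype.card V : ℝ) ^ 2) ^ M

section EdgeMean

variable {V : Type*} [Fintype V] [DecidableEq V] {M : ℕ}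

lemma edgeMean_mono {F G : (Fin M → V × V) → ℝ} (h : ∀ e, F e ≤ G e) :
    edgeMean V M F ≤ edgeMean V M G :=
  div_le_div_of_nonneg_right (Finset.sum_le_sum fun e _ => h e) (by positivity)

lemma edgeMean_add (F G : (Fin M → V × V) → ℝ) :
    edgeMean V M (fun e => F e + G e) = edgeMean V M F + edgeMean V M G := by
  simp only [edgeMean, Finset.sum_add_distrib, add_div]

lemma edgeMean_sub (F G : (Fin M → V × V) → ℝ) :
    edgeMean V M (fun e => F e - G e) = edgeMean V M F - edgeMean V M G := by
  simp only [edgeMean, Finset.sum_sub_distrib, sub_div]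

lemma edgeMean_const_mul (c : ℝ) (F : (Fin M → V × V) → ℝ) :
    edgeMean V M (fun e => c * F e) = c * edgeMean V M F := by
  simp only [edgeMean, ← Finset.mul_sum, mul_div_assoc]

lemma edgeMean_const [Nonempty V] (c : ℝ) : edgeMean V M (fun _ => c) = c := by
  have : (Fintype.card V : ℝ) ≠ 0 := by simp
  simp only [edgeMean, Finset.sum_const, Finset.card_univ, Fintype.card_pi, Fintype.card_prod,
    Finset.prod_const, Fintype.card_fin, nsmul_eq_mul]
  push_cast
  rw [sq]
  field_simp

lemma edgeMean_succ (F : (Fin (M + 1) → V × V) → ℝ) :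
    edgeMean V (M + 1) F = ∑ y, unifEdge V y * edgeMean V M (fun e => F (Fin.cons y e)) := by
  simp only [edgeMean, unifEdge]
  rw [← Finset.mul_sum, ← Finset.sum_div, ← Fintype.sum_prod_type',
    ← (Fin.consEquiv fun _ : Fin (M + 1) => V × V).sum_comp F, pow_succ, div_mul_div_comm,
    one_mul, mul_comm]
  rfl

lemma edgeMean_succ' (F : (Fin (M + 1) → V × V) → ℝ) :
    edgeMean V (M + 1) F = edgeMean V M (fun e => ∑ y, unifEdge V y * F (Fin.cons y e)) := by
  rw [edgeMean_succ]
  simp only [edgeMean, Finset.sum_div, Finset.mul_sum]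
  rw [Finset.sum_comm]
  simp only [mul_div_assoc]

lemma meanLog_unifEdge {q : ℕ} {J : Fin q → Fin q → ℝ} (W : (V → Fin q) → ℝ) :
    meanLog J (unifEdge V) M W =
      edgeMean V M fun e => Real.log (∑ σ, W σ * ∏ m, J (σ (e m).1) (σ (e m).2)) := by
  induction M generalizing W with
  | zero => simp [meanLog, edgeMean]
  | succ M ih =>
    rw [meanLog, edgeMean_succ]
    refine Finset.sum_congr rfl fun y _ => ?_
    rw [ih]
    congr 2
    funext e
    congr 1
    refine Finset.sum_congr rfl fun σ _ => ?_
    rw [Fin.prod_univ_succ]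
    simp [edgeTilt, mul_assoc]

end EdgeMean

/-- The mean of `log Z` over `M` independent uniform edges, for given node potentials. -/
def freeEnergy {q : ℕ} {V : Type*} [Fintype V] [DecidableEq V] (J : Fin q → Fin q → ℝ) (M : ℕ)
    (h : V → Fin q → ℝ) : ℝ :=
  edgeMean V M fun e => Real.log (graphSum J e h)

section FreeEnergy

variable {q : ℕ} {J : Fin q → Fin q → ℝ} {a b δ α : ℝ} {V : Type*} [Fintype V] [DecidableEq V]

lemma freeEnergy_eq_meanLog (M : ℕ) (h : V → Fin q → ℝ) :
    freeEnergy J M h = meanLog J (unifEdge V) M fun σ => ∏ u, h u (σ u) := by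
  rw [meanLog_unifEdge]; rfl

lemma sum_unifEdge_incidence [Nonempty V] {M : ℕ} (e : Fin M → V × V) :
    ∑ y, unifEdge V y * (incidence e y.1 : ℝ) ≤ 2 * M / Fintype.card V := by
  have hN : (0 : ℝ) < Fintype.card V := by exact_mod_cast Fintype.card_pos
  simp only [unifEdge]
  rw [← Finset.mul_sum, Fintype.sum_prod_type]
  simp only [Finset.sum_const, Finset.card_univ, nsmul_eq_mul, ← Finset.mul_sum]
  have := sum_incidence_le e
  rw [← mul_assoc, show 1 / (Fintype.card V : ℝ) ^ 2 * Fintype.card V = 1 / Fintype.card V by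
    field_simp, one_div_mul_eq_div]
  gcongr

/-- The loss is governed by the degree of an endpoint of a uniform new edge, whose mean is at most
`2 * M / card V`. -/
lemma freeEnergy_succ_ge [Nonempty V] (hJ : EdgeBounds J δ α) (ha : 0 < a) (hab : a ≤ b)
    {h : V → Fin q → ℝ} (hh : ∀ u, GoodPot J a b (h u)) (M : ℕ) :
    freeEnergy J M h - lipConst a b δ α * (1 + 2 * M / Fintype.card V) ≤
      freeEnergy J (M + 1) h := by
  unfold freeEnergy
  have hC := (lipConst_spec hJ ha hab).1
  rw [edgeMean_succ', ← edgeMean_const (V := V) (M := M) (lipConst a b δ α * _), ← edgeMean_sub]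
  refine edgeMean_mono fun e => ?_
  calc _ ≤ Real.log (graphSum J e h) -
        lipConst a b δ α * (1 + ∑ y, unifEdge V y * (incidence e y.1 : ℝ)) := by
        gcongr; exact sum_unifEdge_incidence e
    _ = ∑ y, unifEdge V y * (Real.log (graphSum J e h) -
        lipConst a b δ α * (1 + incidence e y.1)) := by
        simp only [mul_sub, mul_add, mul_one, Finset.sum_sub_distrib, Finset.sum_add_distrib,
          ← Finset.sum_mul, sum_unifEdge, one_mul, Finset.mul_sum]
        congr 2
        exact Finset.sum_congr rfl fun y _ => by ring
    _ ≤ _ := Finset.sum_le_sum fun y _ => mul_le_mul_of_nonneg_left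
        (log_graphSum_cons_ge hJ ha hab hh y e) (unifEdge_nonneg V y)

lemma freeEnergy_succ_le [Nonempty V] (hJ : EdgeBounds J δ α) (ha : 0 < a) (hab : a ≤ b)
    {h : V → Fin q → ℝ} (hh : ∀ u, GoodPot J a b (h u)) (M : ℕ) :
    freeEnergy J (M + 1) h ≤ freeEnergy J M h + lipConst a b δ α := by
  unfold freeEnergy
  rw [edgeMean_succ', ← edgeMean_const (V := V) (M := M) (lipConst a b δ α), ← edgeMean_add]
  refine edgeMean_mono fun e => ?_
  calc _ ≤ ∑ y, unifEdge V y * (Real.log (graphSum J e h) + lipConst a b δ α) :=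
        Finset.sum_le_sum fun y _ => mul_le_mul_of_nonneg_left
          (log_graphSum_cons_le hJ ha hab hh y e) (unifEdge_nonneg V y)
    _ = _ := by rw [← Finset.sum_mul, sum_unifEdge, one_mul]

lemma freeEnergy_add_le [Nonempty V] (hJ : EdgeBounds J δ α) (ha : 0 < a) (hab : a ≤ b)
    {h : V → Fin q → ℝ} (hh : ∀ u, GoodPot J a b (h u)) (M d : ℕ) :
    freeEnergy J (M + d) h ≤ freeEnergy J M h + lipConst a b δ α * d := by
  induction d with
  | zero => simp
  | succ d ih =>
    have := freeEnergy_succ_le hJ ha hab hh (M + d)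
    rw [← add_assoc]; push_cast; linarith

lemma freeEnergy_add_ge [Nonempty V] (hJ : EdgeBounds J δ α) (ha : 0 < a) (hab : a ≤ b)
    {h : V → Fin q → ℝ} (hh : ∀ u, GoodPot J a b (h u)) (M d : ℕ) :
    freeEnergy J M h - lipConst a b δ α * (d * (1 + 2 * (M + d) / Fintype.card V)) ≤
      freeEnergy J (M + d) h := by
  have hN : (0 : ℝ) < Fintype.card V := by exact_mod_cast Fintype.card_pos
  have hC := (lipConst_spec hJ ha hab).1
  induction d with
  | zero => simp
  | succ d ih =>
    have h1 := freeEnergy_succ_ge hJ ha hab hh (M + d)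
    rw [← add_assoc]
    refine le_trans ?_ h1
    push_cast at ih ⊢
    have h2 : (d : ℝ) * (1 + 2 * (M + d) / Fintype.card V) +
        (1 + 2 * (M + d) / Fintype.card V) ≤
        (d + 1) * (1 + 2 * (M + (d + 1)) / Fintype.card V) := by
      rw [← add_one_mul]; gcongr; linarith
    have := mul_le_mul_of_nonneg_left h2 hC
    linarith

/-- The loss has a quadratic term because degrees grow while edges are added. In this form only the
second moment of the random edge number `k` is needed later. -/
lemma freeEnergy_ge [Nonempty V] (hJ : EdgeBounds J δ α) (ha : 0 < a) (hab : a ≤ b)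
    {h : V → Fin q → ℝ} (hh : ∀ u, GoodPot J a b (h u)) (k k₀ : ℕ) :
    freeEnergy J k₀ h - lipConst a b δ α * (|(k : ℝ) - k₀| * (1 + 2 * k₀ / Fintype.card V) +
      2 * ((k : ℝ) - k₀) ^ 2 / Fintype.card V) ≤ freeEnergy J k h := by
  have hN : (0 : ℝ) < Fintype.card V := by exact_mod_cast Fintype.card_pos
  have hC := (lipConst_spec hJ ha hab).1
  rcases le_total k₀ k with hk | hk
  · obtain ⟨d, rfl⟩ := Nat.exists_eq_add_of_le hk
    refine le_trans (Eq.le ?_) (freeEnergy_add_ge hJ ha hab hh k₀ d)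
    push_cast
    rw [add_sub_cancel_left, abs_of_nonneg (Nat.cast_nonneg d)]
    ring
  · obtain ⟨d, rfl⟩ := Nat.exists_eq_add_of_le hk
    have := freeEnergy_add_le hJ ha hab hh k d
    push_cast
    rw [show (k : ℝ) - (k + d) = -d by ring, abs_neg, abs_of_nonneg (Nat.cast_nonneg d)]
    have h2 : (d : ℝ) ≤ d * (1 + 2 * (k + d) / Fintype.card V) +
        2 * (-(d : ℝ)) ^ 2 / Fintype.card V := by
      have : (0 : ℝ) ≤ d * (2 * (k + d) / Fintype.card V) +
        2 * (-(d : ℝ)) ^ 2 / Fintype.card V := by positivity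
      linarith
    have := mul_le_mul_of_nonneg_left h2 hC
    linarith

lemma freeEnergy_zero (h : V → Fin q → ℝ) :
    freeEnergy J 0 h = Real.log (∏ u, ∑ i, h u i) := by
  rw [Finset.prod_univ_sum]
  simp [freeEnergy, edgeMean, graphSum]

omit [DecidableEq V] in
lemma log_prod_sum_bounds (ha : 0 < a) {h : V → Fin q → ℝ}
    (hh : ∀ u, GoodPot J a b (h u)) :
    Fintype.card V * Real.log a ≤ Real.log (∏ u, ∑ i, h u i) ∧
      Real.log (∏ u, ∑ i, h u i) ≤ Fintype.card V * Real.log b := by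
  classical
  have h1 : ∀ u, a ≤ ∑ i, h u i := fun u => (hh u).2.1.trans
    (Finset.sum_le_sum_of_subset_of_nonneg (Finset.filter_subset _ _) fun i _ _ => (hh u).1 i)
  rw [Real.log_prod fun u _ => (ha.trans_le (h1 u)).ne']
  constructor
  · rw [← nsmul_eq_mul]
    exact Finset.card_nsmul_le_sum _ _ _ fun u _ => Real.log_le_log ha (h1 u)
  · rw [← nsmul_eq_mul]
    exact Finset.sum_le_card_nsmul _ _ _ fun u _ =>
      Real.log_le_log (ha.trans_le (h1 u)) (hh u).2.2

lemma freeEnergy_le [Nonempty V] (hJ : EdgeBounds J δ α) (ha : 0 < a) (hab : a ≤ b)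
    {h : V → Fin q → ℝ} (hh : ∀ u, GoodPot J a b (h u)) (M : ℕ) :
    freeEnergy J M h ≤ Fintype.card V * Real.log b + lipConst a b δ α * M := by
  have h1 := freeEnergy_add_le hJ ha hab hh 0 M
  rw [zero_add, freeEnergy_zero] at h1
  linarith [(log_prod_sum_bounds ha hh).2]

omit [Fintype V] in
lemma incidence_le {M : ℕ} (e : Fin M → V × V) (u : V) : incidence e u ≤ M :=
  (Finset.card_le_univ _).trans (by simp)

/-- A crude bound, uniform in the potentials; it serves only to make all functions bounded, hence
integrable. -/
lemma exists_abs_log_graphSum_le (hJ : EdgeBounds J δ α) (ha : 0 < a) (hab : a ≤ b) (M : ℕ) :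
    ∃ K, ∀ (e : Fin M → V × V) (h : V → Fin q → ℝ), (∀ u, GoodPot J a b (h u)) →
      |Real.log (graphSum J e h)| ≤ K := by
  have hC := (lipConst_spec hJ ha hab).1
  induction M with
  | zero =>
    refine ⟨max (-(Fintype.card V * Real.log a)) (Fintype.card V * Real.log b), fun e h hh => ?_⟩
    have h0 : Real.log (graphSum J e h) = Real.log (∏ u, ∑ i, h u i) := by
      rw [Finset.prod_univ_sum]; simp [graphSum]
    rw [h0, abs_le]
    have := log_prod_sum_bounds ha hh
    exact ⟨neg_le.1 (le_max_of_le_left (by linarith)), le_max_of_le_right this.2⟩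
  | succ M ih =>
    obtain ⟨K, hK⟩ := ih
    refine ⟨K + lipConst a b δ α * (1 + M), fun e h hh => ?_⟩
    obtain ⟨y, e, rfl⟩ : ∃ (y : V × V) (e' : Fin M → V × V), e = Fin.cons y e' :=
      ⟨e 0, Fin.tail e, (Fin.cons_self_tail e).symm⟩
    have h1 := log_graphSum_cons_ge hJ ha hab hh y e
    have h2 := log_graphSum_cons_le hJ ha hab hh y e
    have h3 := abs_le.1 (hK e h hh)
    have h4 : (incidence e y.1 : ℝ) ≤ M := by exact_mod_cast incidence_le e y.1
    have h5 := mul_le_mul_of_nonneg_left h4 hC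
    have h6 : 0 ≤ lipConst a b δ α * M := mul_nonneg hC (Nat.cast_nonneg M)
    rw [abs_le]
    constructor <;> linarith

lemma freeEnergy_comp_equiv {V' : Type*} [Fintype V'] [DecidableEq V'] (φ : V ≃ V') (M : ℕ)
    (h : V' → Fin q → ℝ) :
    freeEnergy J M (fun u => h (φ u)) = freeEnergy J M h := by
  unfold freeEnergy edgeMean
  rw [Fintype.card_congr φ]
  congr 1
  refine Fintype.sum_equiv (Equiv.arrowCongr (Equiv.refl _) (Equiv.prodCongr φ φ)) _ _ fun e => ?_
  congr 1
  unfold graphSum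
  refine Fintype.sum_equiv (Equiv.arrowCongr φ (Equiv.refl _)) _ _ fun σ => ?_
  congr 1
  · exact Fintype.prod_equiv φ _ _ fun u => by simp
  · exact Finset.prod_congr rfl fun m _ => by simp

end FreeEnergy

/-! ### Superadditivity for fixed node potentials. -/

section Superadditivity

variable {q : ℕ} {J : Fin q → Fin q → ℝ} {a b δ α : ℝ}

/-- The mean edge number of a block differs from its target `⌊c * n₁⌋₊` by at most one, in spite of
the two roundings. -/
lemma sq_natFloor_split_le {c : ℝ} (hc : 0 < c) {n₁ n₂ : ℝ} (h₁ : 0 < n₁) (h₂ : 0 < n₂) :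
    ((⌊c * (n₁ + n₂)⌋₊ : ℝ) * (n₁ / (n₁ + n₂)) - ⌊c * n₁⌋₊) ^ 2 ≤ 1 := by
  have a1 := Nat.floor_le (show 0 ≤ c * (n₁ + n₂) by positivity)
  have a2 := Nat.lt_floor_add_one (c * (n₁ + n₂))
  have b1 := Nat.floor_le (show 0 ≤ c * n₁ by positivity)
  have b2 := Nat.lt_floor_add_one (c * n₁)
  have hp0 : 0 ≤ n₁ / (n₁ + n₂) := by positivity
  have hp1 : n₁ / (n₁ + n₂) ≤ 1 := (div_le_one (by positivity)).2 (by linarith)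
  have e : c * (n₁ + n₂) * (n₁ / (n₁ + n₂)) = c * n₁ := by field_simp
  have c1 := mul_le_mul_of_nonneg_right a1 hp0
  have c2 := mul_le_mul_of_nonneg_right a2.le hp0
  rw [add_mul, one_mul] at c2
  rw [e] at c1 c2
  rw [sq_le_one_iff_abs_le_one, abs_le]
  constructor <;> linarith

/-- Used with `s = √m`, `m` the smaller block size, so that a deviation with mean square of order
`m` has mean absolute value of order `√m`. -/
lemma abs_le_half_add {t s : ℝ} (hs : 0 < s) : |t| ≤ s / 2 + t ^ 2 / (2 * s) := by
  have : 0 ≤ (|t| - s) ^ 2 / (2 * s) := by positivity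
  have e : (|t| - s) ^ 2 / (2 * s) = s / 2 + t ^ 2 / (2 * s) - |t| := by
    rw [sub_sq, sq_abs]; field_simp; ring
  linarith

/-- The loss in one block, for a quadratic mean deviation `v ≤ 1 + c m`. -/
lemma block_error_le {C c n m v k₀ : ℝ} (hC : 0 ≤ C) (hc : 0 < c) (hm : 1 ≤ m) (hmn : m ≤ n)
    (hk : k₀ ≤ c * n) (hv0 : 0 ≤ v) (hv : v ≤ 1 + c * m) :
    C * ((√m / 2 + 1 / (2 * √m) * v) * (1 + 2 * k₀ / n) + 2 / n * v) ≤
      C * ((1 + 2 * c) * (1 + c) + 2 * (1 + c)) * √m := by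
  have hs : 1 ≤ √m := Real.one_le_sqrt.2 hm
  have hs0 : 0 < √m := by linarith
  have hn : 0 < n := by linarith
  have hsq : √m * √m = m := Real.mul_self_sqrt (by linarith)
  have h1 : 2 * k₀ / n ≤ 2 * c := by rw [div_le_iff₀ hn]; linarith
  have hv' : v ≤ (1 + c) * m := by nlinarith
  have h2 : 1 / (2 * √m) * v ≤ (1 + c) * √m / 2 := by
    rw [one_div_mul_eq_div, div_le_iff₀ (by positivity)]; nlinarith
  have h3 : 2 / n * v ≤ 2 * (1 + c) * √m := by
    rw [div_mul_eq_mul_div, div_le_iff₀ hn]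
    have : 2 * (1 + c) * m ≤ 2 * (1 + c) * n * √m := by
      have := mul_le_mul hmn hs zero_le_one hn.le
      nlinarith
    nlinarith
  rw [mul_assoc]
  refine mul_le_mul_of_nonneg_left ?_ hC
  have h4 : (√m / 2 + 1 / (2 * √m) * v) * (1 + 2 * k₀ / n) ≤
      (√m / 2 + (1 + c) * √m / 2) * (1 + 2 * c) := by
    have : 0 ≤ √m / 2 + 1 / (2 * √m) * v := by positivity
    nlinarith
  have h5 : (√m / 2 + (1 + c) * √m / 2) * (1 + 2 * c) ≤ (1 + 2 * c) * (1 + c) * √m := by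
    nlinarith [mul_pos hc hs0, mul_pos hc (mul_pos hc hs0)]
  linarith

/-- The constant in front of the error term of the superadditivity inequality. -/
def errConst (a b δ α c : ℝ) : ℝ :=
  2 * (lipConst a b δ α * ((1 + 2 * c) * (1 + c) + 2 * (1 + c)))

lemma freeEnergy_superadditive {V₁ V₂ : Type*} [Fintype V₁] [Fintype V₂] [DecidableEq V₁]
    [DecidableEq V₂] [Nonempty V₁] [Nonempty V₂] (hJ : EdgeBounds J δ α) (ha : 0 < a)
    (hab : a ≤ b) (hpsd : (Matrix.of fun i j => α - J i j).PosSemidef) {c : ℝ} (hc : 0 < c)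
    {h : V₁ ⊕ V₂ → Fin q → ℝ} (hh : ∀ u, GoodPot J a b (h u)) :
    freeEnergy J ⌊c * Fintype.card V₁⌋₊ (fun u => h (.inl u)) +
      freeEnergy J ⌊c * Fintype.card V₂⌋₊ (fun u => h (.inr u)) -
      errConst a b δ α c * √(min (Fintype.card V₁ : ℝ) (Fintype.card V₂)) ≤
    freeEnergy J ⌊c * Fintype.card (V₁ ⊕ V₂)⌋₊ h := by
  have hn₁ : (1 : ℝ) ≤ Fintype.card V₁ := by exact_mod_cast Fintype.card_pos
  have hn₂ : (1 : ℝ) ≤ Fintype.card V₂ := by exact_mod_cast Fintype.card_pos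
  have hC := (lipConst_spec hJ ha hab).1
  have hW₁ := posWeight_prod (J := J) ha fun u => hh (.inl u)
  have hW₂ := posWeight_prod (J := J) ha fun u => hh (.inr u)
  have hh₁ : ∀ u, GoodPot J a b (h (.inl u)) := fun u => hh _
  have hh₂ : ∀ u, GoodPot J a b (h (.inr u)) := fun u => hh _
  set M := ⌊c * Fintype.card (V₁ ⊕ V₂)⌋₊ with hM
  have hint := meanLog_splitEdge_le hJ.max_pos hJ.nonneg hJ.le_max hpsd M
    (posWeight_prod (J := J) ha hh)
  rw [← freeEnergy_eq_meanLog] at hint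
  have hfac := meanLog_splitEdge_eq hJ.nonneg M hW₁ hW₂
  simp only [← freeEnergy_eq_meanLog (J := J) _ fun u => h (.inl u),
    ← freeEnergy_eq_meanLog (J := J) _ fun u => h (.inr u)] at hfac
  simp only [Fintype.prod_sum_type] at hint
  rw [hfac] at hint
  refine le_trans ?_ hint
  set n₁ : ℝ := (Fintype.card V₁ : ℝ) with hn₁d
  set n₂ : ℝ := (Fintype.card V₂ : ℝ) with hn₂d
  have hM' : M = ⌊c * (n₁ + n₂)⌋₊ := by rw [hM, Fintype.card_sum]; push_cast; rfl
  set p := n₁ / (n₁ + n₂) with hp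
  have hp0 : 0 ≤ p := by positivity
  have hp1 : p ≤ 1 := (div_le_one (by positivity)).2 (by linarith)
  have h1p : 1 - p = n₂ / (n₁ + n₂) := by rw [hp]; field_simp; ring
  set m := min n₁ n₂ with hm
  have hm1 : 1 ≤ m := le_min hn₁ hn₂
  have hs : 0 < √m := Real.sqrt_pos.2 (by linarith)
  have hvar : (M : ℝ) * p * (1 - p) ≤ c * m := by
    have e1 : (M : ℝ) ≤ c * (n₁ + n₂) := by rw [hM']; exact Nat.floor_le (by positivity)
    have e2 : (M : ℝ) * p ≤ c * n₁ := by
      calc _ ≤ c * (n₁ + n₂) * p := by gcongr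
        _ = _ := by rw [hp]; field_simp
    have e3 : (M : ℝ) * (1 - p) ≤ c * n₂ := by
      calc _ ≤ c * (n₁ + n₂) * (1 - p) := by
            have := sub_nonneg.2 hp1; gcongr
        _ = _ := by rw [h1p]; field_simp
    have hM0 : (0 : ℝ) ≤ M := Nat.cast_nonneg _
    -- Bound by one the factor `1 - p` or `p`, according to which block is smaller.
    rcases min_choice n₁ n₂ with h' | h' <;> rw [hm, h']
    · have := mul_nonneg hM0 hp0; nlinarith
    · have := mul_nonneg hM0 (sub_nonneg.2 hp1); nlinarith
  set k₀ := ⌊c * n₁⌋₊ with hk₀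
  set l₀ := ⌊c * n₂⌋₊ with hl₀
  set C := lipConst a b δ α with hCd
  set v₁ := ((M : ℝ) * p - k₀) ^ 2 + M * p * (1 - p) with hv₁
  set v₂ := ((M : ℝ) * (1 - p) - l₀) ^ 2 + M * p * (1 - p) with hv₂
  have hMpp : 0 ≤ (M : ℝ) * p * (1 - p) :=
    mul_nonneg (mul_nonneg (Nat.cast_nonneg _) hp0) (sub_nonneg.2 hp1)
  have hv₁1 : v₁ ≤ 1 + c * m := by
    have := sq_natFloor_split_le hc (n₁ := n₁) (n₂ := n₂) (by linarith) (by linarith)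
    rw [← hM', ← hp, ← hk₀] at this
    linarith
  have hv₂1 : v₂ ≤ 1 + c * m := by
    have := sq_natFloor_split_le hc (n₁ := n₂) (n₂ := n₁) (by linarith) (by linarith)
    rw [add_comm n₂ n₁, ← hM', ← h1p, ← hl₀] at this
    linarith
  -- A lower bound affine in the two squared deviations, so that its binomial mean is explicit.
  have hlow : ∀ k l : ℕ,
      (freeEnergy J k₀ (fun u => h (.inl u)) + freeEnergy J l₀ (fun u => h (.inr u)) -
        C * (√m / 2 * (1 + 2 * k₀ / n₁)) - C * (√m / 2 * (1 + 2 * l₀ / n₂))) +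
      ((-(C * (1 / (2 * √m) * (1 + 2 * k₀ / n₁) + 2 / n₁))) * ((k : ℝ) - k₀) ^ 2 +
       (-(C * (1 / (2 * √m) * (1 + 2 * l₀ / n₂) + 2 / n₂))) * ((l : ℝ) - l₀) ^ 2) ≤
      freeEnergy J k (fun u => h (.inl u)) + freeEnergy J l (fun u => h (.inr u)) := by
    intro k l
    have f1 := freeEnergy_ge hJ ha hab hh₁ k k₀
    have f2 := freeEnergy_ge hJ ha hab hh₂ l l₀
    have g1 : |(k : ℝ) - k₀| * (1 + 2 * k₀ / n₁) ≤
        (√m / 2 + ((k : ℝ) - k₀) ^ 2 / (2 * √m)) * (1 + 2 * k₀ / n₁) :=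
      mul_le_mul_of_nonneg_right (abs_le_half_add hs) (by positivity)
    have g2 : |(l : ℝ) - l₀| * (1 + 2 * l₀ / n₂) ≤
        (√m / 2 + ((l : ℝ) - l₀) ^ 2 / (2 * √m)) * (1 + 2 * l₀ / n₂) :=
      mul_le_mul_of_nonneg_right (abs_le_half_add hs) (by positivity)
    have g1' := mul_le_mul_of_nonneg_left g1 hC
    have g2' := mul_le_mul_of_nonneg_left g2 hC
    refine le_trans ?_ (add_le_add f1 f2)
    have r1 : C * ((√m / 2 + ((k : ℝ) - k₀) ^ 2 / (2 * √m)) * (1 + 2 * k₀ / n₁)) +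
        C * (2 * ((k : ℝ) - k₀) ^ 2 / n₁) = C * (√m / 2 * (1 + 2 * k₀ / n₁)) +
        C * (1 / (2 * √m) * (1 + 2 * k₀ / n₁) + 2 / n₁) * ((k : ℝ) - k₀) ^ 2 := by ring
    have r2 : C * ((√m / 2 + ((l : ℝ) - l₀) ^ 2 / (2 * √m)) * (1 + 2 * l₀ / n₂)) +
        C * (2 * ((l : ℝ) - l₀) ^ 2 / n₂) = C * (√m / 2 * (1 + 2 * l₀ / n₂)) +
        C * (1 / (2 * √m) * (1 + 2 * l₀ / n₂) + 2 / n₂) * ((l : ℝ) - l₀) ^ 2 := by ring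
    rw [mul_add C, mul_add C]
    linarith
  refine le_trans ?_ (binomMean_mono hp0 hp1 M hlow)
  rw [binomMean_add, binomMean_const, binomMean_add, binomMean_const_mul, binomMean_const_mul,
    binomMean_sq_left, binomMean_sq_right, ← hv₁, ← hv₂]
  have b1 := block_error_le hC hc hm1 (min_le_left n₁ n₂)
    (Nat.floor_le (show 0 ≤ c * n₁ by positivity)) (show 0 ≤ v₁ by positivity) hv₁1
  have b2 := block_error_le hC hc hm1 (min_le_right n₁ n₂)
    (Nat.floor_le (show 0 ≤ c * n₂ by positivity)) (show 0 ≤ v₂ by positivity) hv₂1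
  rw [← hk₀] at b1
  rw [← hl₀] at b2
  unfold errConst
  rw [← hCd]
  linarith

end Superadditivity

/-! ### Variance identities and the Efron-Stein inequality. -/

/-- Bounded measurable real functions. -/
structure BddMeas {X : Type*} [MeasurableSpace X] (f : X → ℝ) : Prop where
  meas : Measurable f
  bdd : ∃ K, ∀ x, |f x| ≤ K

namespace BddMeas

variable {X Y : Type*} [MeasurableSpace X] [MeasurableSpace Y] {f g : X → ℝ}

lemma integrable (hf : BddMeas f) (μ : Measure X) [IsFiniteMeasure μ] : Integrable f μ := by
  obtain ⟨K, hK⟩ := hf.bdd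
  exact Integrable.of_bound hf.meas.aestronglyMeasurable K (Eventually.of_forall hK)

lemma const (c : ℝ) : BddMeas fun _ : X => c := ⟨measurable_const, |c|, fun _ => le_rfl⟩

lemma sub (hf : BddMeas f) (hg : BddMeas g) : BddMeas fun x => f x - g x := by
  obtain ⟨K, hK⟩ := hf.bdd
  obtain ⟨L, hL⟩ := hg.bdd
  exact ⟨hf.meas.sub hg.meas, K + L, fun x => (abs_sub _ _).trans (add_le_add (hK x) (hL x))⟩

lemma add (hf : BddMeas f) (hg : BddMeas g) : BddMeas fun x => f x + g x := by
  obtain ⟨K, hK⟩ := hf.bdd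
  obtain ⟨L, hL⟩ := hg.bdd
  exact ⟨hf.meas.add hg.meas, K + L, fun x => (abs_add_le _ _).trans (add_le_add (hK x) (hL x))⟩

lemma sq (hf : BddMeas f) : BddMeas fun x => f x ^ 2 := by
  obtain ⟨K, hK⟩ := hf.bdd
  refine ⟨hf.meas.pow_const 2, K ^ 2, fun x => ?_⟩
  rw [abs_pow]
  exact pow_le_pow_left₀ (abs_nonneg _) (hK x) 2

lemma comp (hf : BddMeas f) {φ : Y → X} (hφ : Measurable φ) : BddMeas fun y => f (φ y) :=
  ⟨hf.meas.comp hφ, hf.bdd.imp fun _ hK y => hK (φ y)⟩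

lemma integral_right {F : X × Y → ℝ} (hF : BddMeas F) (μ : Measure Y) [IsProbabilityMeasure μ] :
    BddMeas fun x => ∫ y, F (x, y) ∂μ := by
  obtain ⟨K, hK⟩ := hF.bdd
  refine ⟨(hF.meas.stronglyMeasurable.integral_prod_right' (ν := μ)).measurable, K, fun x => ?_⟩
  have := norm_integral_le_of_norm_le_const (μ := μ) (f := fun y => F (x, y)) (C := K)
    (Eventually.of_forall fun y => hK _)
  simpa using this

end BddMeas

section Variance

variable {X Y : Type*} [MeasurableSpace X] [MeasurableSpace Y]

lemma integral_sub_sq_eq {μ : Measure X} [IsProbabilityMeasure μ] {f : X → ℝ} (hf : BddMeas f)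
    (c : ℝ) :
    ∫ x, (f x - c) ^ 2 ∂μ = ∫ x, (f x - ∫ y, f y ∂μ) ^ 2 ∂μ + (∫ y, f y ∂μ - c) ^ 2 := by
  set m := ∫ y, f y ∂μ with hm
  have h1 : ∀ x, (f x - c) ^ 2 = (f x - m) ^ 2 + (2 * (m - c) * (f x - m) + (m - c) ^ 2) := by
    intro x; ring
  simp only [h1]
  have i1 := ((hf.sub (.const m)).sq).integrable μ
  have i2 := (hf.sub (.const m)).integrable μ
  have i3 : Integrable (fun x => 2 * (m - c) * (f x - m) + (m - c) ^ 2) μ :=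
    (i2.const_mul _).add (integrable_const _)
  rw [integral_add i1 i3, integral_add (i2.const_mul _) (integrable_const _), integral_const_mul,
    integral_sub (hf.integrable μ) (integrable_const _)]
  simp [← hm]

lemma integral_sub_mean_sq_le {μ : Measure X} [IsProbabilityMeasure μ] {f : X → ℝ}
    (hf : BddMeas f) (c : ℝ) :
    ∫ x, (f x - ∫ y, f y ∂μ) ^ 2 ∂μ ≤ ∫ x, (f x - c) ^ 2 ∂μ := by
  rw [integral_sub_sq_eq hf c]
  linarith [sq_nonneg (∫ y, f y ∂μ - c)]

lemma sq_integral_le {μ : Measure X} [IsProbabilityMeasure μ] {f : X → ℝ} (hf : BddMeas f) :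
    (∫ x, f x ∂μ) ^ 2 ≤ ∫ x, f x ^ 2 ∂μ := by
  have h1 := integral_sub_sq_eq (μ := μ) hf 0
  simp only [sub_zero] at h1
  rw [h1]
  have : 0 ≤ ∫ x, (f x - ∫ y, f y ∂μ) ^ 2 ∂μ := integral_nonneg fun x => sq_nonneg _
  linarith

lemma measurable_finCons {n : ℕ} :
    Measurable fun z : X × (Fin n → X) => (Fin.cons z.1 z.2 : Fin (n + 1) → X) := by
  refine measurable_pi_lambda _ fun i => ?_
  refine Fin.cases ?_ (fun j => ?_) i
  · simpa using measurable_fst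
  · simpa using! (measurable_pi_apply j).comp measurable_snd

lemma integral_pi_succ {μ : Measure X} [IsProbabilityMeasure μ] {n : ℕ}
    {f : (Fin (n + 1) → X) → ℝ} (hf : BddMeas f) :
    ∫ x, f x ∂(Measure.pi fun _ => μ) =
      ∫ w, ∫ x, f (Fin.cons w x) ∂(Measure.pi fun _ : Fin n => μ) ∂μ := by
  have h1 := (measurePreserving_piFinSuccAbove (fun _ : Fin (n + 1) => μ) 0).symm
  rw [← h1.integral_comp (MeasurableEquiv.measurableEmbedding _),
    ← integral_prod (fun z : X × (Fin n → X) => f (Fin.cons z.1 z.2))]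
  · refine integral_congr_ae (Eventually.of_forall fun z => ?_)
    change f (Fin.insertNth 0 z.1 z.2) = _
    rw [Fin.insertNth_zero']
  · exact (hf.comp measurable_finCons).integrable _

/-- The Efron-Stein inequality for bounded functions of independent variables. -/
lemma efronStein {μ : Measure X} [IsProbabilityMeasure μ] {n : ℕ} {f : (Fin n → X) → ℝ}
    {D : Fin n → (Fin n → X) → ℝ} (hf : BddMeas f) (hD : ∀ i, BddMeas (D i))
    (hfD : ∀ i x, ∃ a, ∫ y, (f (Function.update x i y) - a) ^ 2 ∂μ ≤ D i x) :
    ∫ x, (f x - ∫ y, f y ∂(Measure.pi fun _ => μ)) ^ 2 ∂(Measure.pi fun _ => μ) ≤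
      ∑ i, ∫ x, D i x ∂(Measure.pi fun _ => μ) := by
  induction n with
  | zero =>
    have : ∀ x : Fin 0 → X, f x = f Fin.elim0 := fun x => congrArg f (Subsingleton.elim _ _)
    simp [this]
  | succ n ih =>
    set P := Measure.pi fun _ : Fin n => μ with hP
    set m := ∫ y, f y ∂(Measure.pi fun _ : Fin (n + 1) => μ) with hm
    have hF : BddMeas fun z : X × (Fin n → X) => f (Fin.cons z.1 z.2) :=
      hf.comp measurable_finCons
    have hFw : ∀ w, BddMeas fun x : Fin n → X => f (Fin.cons w x) := fun w =>
      hF.comp (measurable_prodMk_left)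
    have hFx : ∀ x : Fin n → X, BddMeas fun w => f (Fin.cons w x) := fun x =>
      hF.comp (measurable_prodMk_right)
    have hDF : ∀ i, BddMeas fun z : X × (Fin n → X) => D i (Fin.cons z.1 z.2) := fun i =>
      (hD i).comp measurable_finCons
    set g : X → ℝ := fun w => ∫ x, f (Fin.cons w x) ∂P with hg
    have hgB : BddMeas g := hF.integral_right P
    set k : (Fin n → X) → ℝ := fun x => ∫ w, f (Fin.cons w x) ∂μ with hk
    have hkB : BddMeas k := BddMeas.integral_right (F := fun z : (Fin n → X) × X =>
      f (Fin.cons z.2 z.1)) (hF.comp measurable_swap) μ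
    have hmg : m = ∫ w, g w ∂μ := integral_pi_succ hf
    have hmk : m = ∫ x, k x ∂P := by
      rw [hmg, hg, hk]
      exact integral_integral_swap (hF.integrable (μ.prod P))
    have e0 : ∫ x, (f x - m) ^ 2 ∂(Measure.pi fun _ : Fin (n + 1) => μ) =
        ∫ w, ∫ x, (f (Fin.cons w x) - m) ^ 2 ∂P ∂μ := integral_pi_succ ((hf.sub (.const m)).sq)
    rw [e0, Fin.sum_univ_succ]
    -- Condition on the first coordinate: the inner variance is left to the induction hypothesis,
    -- and the variance of the conditional mean `g` to Jensen's inequality.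
    have e1 : ∀ w, ∫ x, (f (Fin.cons w x) - m) ^ 2 ∂P =
        ∫ x, (f (Fin.cons w x) - g w) ^ 2 ∂P + (g w - m) ^ 2 := fun w =>
      integral_sub_sq_eq (hFw w) m
    have e2 : ∀ w, ∫ x, (f (Fin.cons w x) - g w) ^ 2 ∂P ≤
        ∑ i : Fin n, ∫ x, D i.succ (Fin.cons w x) ∂P := fun w => by
      refine ih (f := fun x => f (Fin.cons w x)) (D := fun i x => D i.succ (Fin.cons w x))
        (hFw w) (fun i => (hDF i.succ).comp measurable_prodMk_left) fun i x => ?_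
      obtain ⟨a, ha⟩ := hfD i.succ (Fin.cons w x)
      refine ⟨a, ?_⟩
      simpa only [Fin.cons_update] using ha
    have hsumB : BddMeas fun w => ∑ i : Fin n, ∫ x, D i.succ (Fin.cons w x) ∂P := by
      have : ∀ i : Fin n, BddMeas fun w => ∫ x, D i.succ (Fin.cons w x) ∂P := fun i =>
        (hDF i.succ).integral_right P
      choose K hK using fun i => (this i).bdd
      exact ⟨Finset.measurable_sum _ fun i _ => (this i).meas, ∑ i, K i, fun w =>
        (Finset.abs_sum_le_sum_abs _ _).trans (Finset.sum_le_sum fun i _ => hK i w)⟩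
    have e3 : ∫ w, (g w - m) ^ 2 ∂μ ≤ ∫ x, D 0 x ∂(Measure.pi fun _ : Fin (n + 1) => μ) := by
      have hdiff : BddMeas fun z : X × (Fin n → X) => f (Fin.cons z.1 z.2) - k z.2 :=
        hF.sub (hkB.comp measurable_snd)
      calc ∫ w, (g w - m) ^ 2 ∂μ
          ≤ ∫ w, ∫ x, (f (Fin.cons w x) - k x) ^ 2 ∂P ∂μ := by
            refine integral_mono ((hgB.sub (.const m)).sq.integrable μ)
              ((hdiff.sq.integral_right P).integrable μ) fun w => ?_
            have : g w - m = ∫ x, (f (Fin.cons w x) - k x) ∂P := by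
              rw [integral_sub ((hFw w).integrable P) (hkB.integrable P), ← hmk]
            simp only [this]
            exact sq_integral_le (hdiff.comp measurable_prodMk_left)
        _ = ∫ x, ∫ w, (f (Fin.cons w x) - k x) ^ 2 ∂μ ∂P :=
            integral_integral_swap (hdiff.sq.integrable (μ.prod P))
        _ ≤ ∫ x, ∫ w, D 0 (Fin.cons w x) ∂μ ∂P := by
            refine integral_mono
              ((BddMeas.integral_right (F := fun z : (Fin n → X) × X =>
                (f (Fin.cons z.2 z.1) - k z.1) ^ 2)
                (hdiff.sq.comp measurable_swap) μ).integrable P)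
              ((BddMeas.integral_right (F := fun z : (Fin n → X) × X =>
                D 0 (Fin.cons z.2 z.1)) ((hDF 0).comp measurable_swap) μ).integrable P) fun x => ?_
            -- The mean `k x` is the best centre, so any centre `a`, even one depending on `w`,
            -- gives an upper bound; the bound is then averaged over `w`.
            have hle : ∀ w, ∫ w', (f (Fin.cons w' x) - k x) ^ 2 ∂μ ≤ D 0 (Fin.cons w x) := by
              intro w
              obtain ⟨a, ha⟩ := hfD 0 (Fin.cons w x)
              simp only [Fin.update_cons_zero] at ha
              exact (integral_sub_mean_sq_le (hFx x) a).trans ha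
            have := integral_mono (μ := μ) (integrable_const _)
              (((hDF 0).comp measurable_prodMk_right).integrable μ) hle
            simpa using this
        _ = ∫ w, ∫ x, D 0 (Fin.cons w x) ∂P ∂μ :=
            (integral_integral_swap ((hDF 0).integrable (μ.prod P))).symm
        _ = _ := (integral_pi_succ (hD 0)).symm
    have e4 : ∑ i : Fin n, ∫ x, D i.succ x ∂(Measure.pi fun _ : Fin (n + 1) => μ) =
        ∫ w, ∑ i : Fin n, ∫ x, D i.succ (Fin.cons w x) ∂P ∂μ := by
      rw [integral_finsetSum _ fun i _ => ((hDF i.succ).integral_right P).integrable μ]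
      exact Finset.sum_congr rfl fun i _ => integral_pi_succ (hD i.succ)
    have e5 : BddMeas fun w => ∫ x, (f (Fin.cons w x) - g w) ^ 2 ∂P :=
      BddMeas.integral_right (F := fun z : X × (Fin n → X) => (f (Fin.cons z.1 z.2) - g z.1) ^ 2)
        (hF.sub (hgB.comp measurable_fst)).sq P
    simp only [e1]
    rw [integral_add (e5.integrable μ) ((hgB.sub (.const m)).sq.integrable μ), e4, add_comm]
    exact add_le_add e3 (integral_mono (e5.integrable μ) (hsumB.integrable μ) e2)

end Variance

/-! ### Convergence of the normalized mean of `log Z`. -/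

section Mean

variable {q : ℕ} {J : Fin q → Fin q → ℝ} {a b δ α : ℝ} {g : (Fin q → ℝ) → Fin q → ℝ}

lemma bddMeas_log_graphSum {V : Type*} [Fintype V] [DecidableEq V] (hJ : EdgeBounds J δ α)
    (ha : 0 < a) (hab : a ≤ b) (hg : Measurable g) (hgood : ∀ ω, GoodPot J a b (g ω)) {M : ℕ}
    (e : Fin M → V × V) :
    BddMeas fun x : V → Fin q → ℝ => Real.log (graphSum J e fun u => g (x u)) := by
  obtain ⟨K, hK⟩ := exists_abs_log_graphSum_le (V := V) hJ ha hab M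
  refine ⟨Real.measurable_log.comp ?_, K, fun x => hK e _ fun u => hgood _⟩
  refine Finset.measurable_sum _ fun σ _ => Measurable.mul_const ?_ _
  exact Finset.measurable_prod _ fun u _ =>
    (measurable_pi_apply (σ u)).comp (hg.comp (measurable_pi_apply u))

lemma bddMeas_freeEnergy {V : Type*} [Fintype V] [DecidableEq V] (hJ : EdgeBounds J δ α)
    (ha : 0 < a) (hab : a ≤ b) (hg : Measurable g) (hgood : ∀ ω, GoodPot J a b (g ω)) (M : ℕ) :
    BddMeas fun x : V → Fin q → ℝ => freeEnergy J M fun u => g (x u) := by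
  have h1 := fun e : Fin M → V × V => bddMeas_log_graphSum hJ ha hab hg hgood e
  choose K hK using fun e => (h1 e).bdd
  refine ⟨(Finset.measurable_sum _ fun e _ => (h1 e).meas).div_const _,
    (∑ e, K e) / ((Fintype.card V : ℝ) ^ 2) ^ M, fun x => ?_⟩
  unfold freeEnergy edgeMean
  rw [abs_div, abs_of_nonneg (show (0 : ℝ) ≤ ((Fintype.card V : ℝ) ^ 2) ^ M by positivity)]
  gcongr
  exact (Finset.abs_sum_le_sum_abs _ _).trans (Finset.sum_le_sum fun e _ => hK e x)

/-- Some of the coordinates of an independent family are again independent with the same law; this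
identifies the contribution of each block. -/
lemma integral_pi_comp_injective {X : Type*} [MeasurableSpace X] (μ : Measure X)
    [IsProbabilityMeasure μ] {V V' : Type*} [Fintype V] [Fintype V'] {f : V' → V}
    (hf : f.Injective) {F : (V' → X) → ℝ} (hF : Measurable F) :
    ∫ x : V → X, F (fun u => x (f u)) ∂(Measure.pi fun _ => μ) =
      ∫ x, F x ∂(Measure.pi fun _ => μ) := by
  have hind := (ProbabilityTheory.iIndepFun_pi (μ := fun _ : V => μ) (X := fun _ x => x)
    fun _ => aemeasurable_id).precomp hf
  rw [ProbabilityTheory.iIndepFun_iff_map_fun_eq_pi_map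
    fun i => (measurable_pi_apply (f i)).aemeasurable] at hind
  have hev : ∀ i, (Measure.pi fun _ : V => μ).map (fun x => x (f i)) = μ := fun i =>
    (measurePreserving_eval (fun _ : V => μ) (f i)).map_eq
  simp only [hev] at hind
  rw [← hind, integral_map]
  · exact (measurable_pi_lambda _ fun i => measurable_pi_apply (f i)).aemeasurable
  · exact hF.aestronglyMeasurable

/-- The mean of `log Z(G(N, c))`. -/
def meanFreeEnergy (J : Fin q → Fin q → ℝ) (ν : Measure (Fin q → ℝ))
    (g : (Fin q → ℝ) → Fin q → ℝ) (c : ℝ) (N : ℕ) : ℝ :=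
  ∫ x : Fin N → Fin q → ℝ, freeEnergy J ⌊c * N⌋₊ (fun u => g (x u)) ∂(Measure.pi fun _ => ν)

lemma meanFreeEnergy_superadditive (hJ : EdgeBounds J δ α) (ha : 0 < a) (hab : a ≤ b)
    (hpsd : (Matrix.of fun i j => α - J i j).PosSemidef) (hg : Measurable g)
    (hgood : ∀ ω, GoodPot J a b (g ω)) {c : ℝ} (hc : 0 < c) (ν : Measure (Fin q → ℝ))
    [IsProbabilityMeasure ν] {n₁ n₂ : ℕ} (hn₁ : n₁ ≠ 0) (hn₂ : n₂ ≠ 0) :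
    meanFreeEnergy J ν g c n₁ + meanFreeEnergy J ν g c n₂ -
      errConst a b δ α c * √(min (n₁ : ℝ) n₂) ≤ meanFreeEnergy J ν g c (n₁ + n₂) := by
  have : Nonempty (Fin n₁) := Fin.pos_iff_nonempty.1 (Nat.pos_of_ne_zero hn₁)
  have : Nonempty (Fin n₂) := Fin.pos_iff_nonempty.1 (Nat.pos_of_ne_zero hn₂)
  have B := fun (n : ℕ) (M : ℕ) => bddMeas_freeEnergy (V := Fin n) hJ ha hab hg hgood M
  have c1 : Measurable fun (x : Fin (n₁ + n₂) → Fin q → ℝ) (u : Fin n₁) => x (Fin.castAdd n₂ u) :=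
    measurable_pi_lambda _ fun i => measurable_pi_apply _
  have c2 : Measurable fun (x : Fin (n₁ + n₂) → Fin q → ℝ) (u : Fin n₂) => x (Fin.natAdd n₁ u) :=
    measurable_pi_lambda _ fun i => measurable_pi_apply _
  have I1 := ((B n₁ ⌊c * n₁⌋₊).comp c1).integrable (Measure.pi fun _ => ν)
  have I2 := ((B n₂ ⌊c * n₂⌋₊).comp c2).integrable (Measure.pi fun _ => ν)
  have I12 := (((B n₁ ⌊c * n₁⌋₊).comp c1).add ((B n₂ ⌊c * n₂⌋₊).comp c2)).integrable
    (Measure.pi fun _ => ν)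
  have e1 := integral_pi_comp_injective ν (Fin.castAdd_injective n₁ n₂) (B n₁ ⌊c * n₁⌋₊).meas
  have e2 := integral_pi_comp_injective ν (Fin.natAdd_injective n₂ n₁) (B n₂ ⌊c * n₂⌋₊).meas
  unfold meanFreeEnergy
  rw [← e1, ← e2, ← integral_add I1 I2]
  have hk : errConst a b δ α c * √(min (n₁ : ℝ) n₂) =
      ∫ _x : Fin (n₁ + n₂) → Fin q → ℝ, errConst a b δ α c * √(min (n₁ : ℝ) n₂)
        ∂(Measure.pi fun _ => ν) := by simp
  rw [hk, ← integral_sub I12 (integrable_const _)]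
  refine integral_mono (I12.sub (integrable_const _)) ((B _ _).integrable _) fun x => ?_
  have := freeEnergy_superadditive (V₁ := Fin n₁) (V₂ := Fin n₂) hJ ha hab hpsd hc
    (h := fun u => g (x (finSumFinEquiv u))) fun u => hgood _
  rw [freeEnergy_comp_equiv finSumFinEquiv _ fun u => g (x u)] at this
  simpa using this

/-- The concavity gain of the square root dominates the error `√(min x y)` of superadditivity, so
adding a multiple of `√N` makes the inequality exact. -/
lemma half_sqrt_min_le {x y : ℝ} (hx : 0 ≤ x) (hy : 0 ≤ y) :
    √(min x y) / 2 ≤ √x + √y - √(x + y) := by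
  wlog h : x ≤ y generalizing x y
  · rw [min_comm, add_comm (√x), add_comm x]
    exact this hy hx (le_of_not_ge h)
  rw [min_eq_left h]
  have h1 : √(x + y) ≤ √y + √x / 2 := by
    rw [Real.sqrt_le_left (by positivity)]
    have h2 := Real.sqrt_le_sqrt h
    have h3 := Real.mul_self_sqrt hx
    have h4 := Real.mul_self_sqrt hy
    nlinarith [mul_le_mul_of_nonneg_left h2 (Real.sqrt_nonneg x)]
  linarith

lemma meanFreeEnergy_zero (c : ℝ) (ν : Measure (Fin q → ℝ)) [IsProbabilityMeasure ν] :
    meanFreeEnergy J ν g c 0 = 0 := by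
  unfold meanFreeEnergy
  have : ⌊c * ((0 : ℕ) : ℝ)⌋₊ = 0 := by simp
  rw [this]
  simp [freeEnergy_zero]

lemma meanFreeEnergy_le (hJ : EdgeBounds J δ α) (ha : 0 < a) (hab : a ≤ b) (hg : Measurable g)
    (hgood : ∀ ω, GoodPot J a b (g ω)) {c : ℝ} (hc : 0 < c) (ν : Measure (Fin q → ℝ))
    [IsProbabilityMeasure ν] (N : ℕ) :
    meanFreeEnergy J ν g c N ≤ (|Real.log b| + lipConst a b δ α * c) * N := by
  rcases Nat.eq_zero_or_pos N with rfl | hN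
  · simp [meanFreeEnergy_zero]
  have : Nonempty (Fin N) := Fin.pos_iff_nonempty.1 hN
  have hC := (lipConst_spec hJ ha hab).1
  have h1 : ∀ x : Fin N → Fin q → ℝ, freeEnergy J ⌊c * N⌋₊ (fun u => g (x u)) ≤
      (|Real.log b| + lipConst a b δ α * c) * N := fun x => by
    have := freeEnergy_le hJ ha hab (h := fun u => g (x u)) (fun u => hgood _) ⌊c * N⌋₊
    rw [Fintype.card_fin] at this
    have h2 := mul_le_mul_of_nonneg_left (Nat.floor_le (show 0 ≤ c * (N : ℝ) by positivity)) hC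
    have h3 := mul_le_mul_of_nonneg_left (le_abs_self (Real.log b)) (Nat.cast_nonneg (α := ℝ) N)
    linarith
  have := integral_mono (μ := Measure.pi fun _ : Fin N => ν)
    ((bddMeas_freeEnergy (V := Fin N) hJ ha hab hg hgood ⌊c * N⌋₊).integrable _)
    (integrable_const _) h1
  simpa [meanFreeEnergy] using this

lemma exists_tendsto_meanFreeEnergy (hJ : EdgeBounds J δ α) (ha : 0 < a) (hab : a ≤ b)
    (hpsd : (Matrix.of fun i j => α - J i j).PosSemidef) (hg : Measurable g)
    (hgood : ∀ ω, GoodPot J a b (g ω)) {c : ℝ} (hc : 0 < c) (ν : Measure (Fin q → ℝ))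
    [IsProbabilityMeasure ν] :
    ∃ z, Tendsto (fun N : ℕ => meanFreeEnergy J ν g c N / N) atTop (𝓝 z) := by
  have hC := (lipConst_spec hJ ha hab).1
  set E := errConst a b δ α c with hE
  have hE0 : 0 ≤ E := by rw [hE, errConst]; positivity
  -- The sign is reversed to use Fekete's lemma in subadditive form; the factor `2` compensates the
  -- one half in `half_sqrt_min_le`.
  set u : ℕ → ℝ := fun N => 2 * E * √N - meanFreeEnergy J ν g c N with hu
  have hsub : Subadditive u := by
    intro m n
    rcases eq_or_ne m 0 with rfl | hm
    · simp [hu, meanFreeEnergy_zero]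
    rcases eq_or_ne n 0 with rfl | hn
    · simp [hu, meanFreeEnergy_zero]
    have h1 := meanFreeEnergy_superadditive hJ ha hab hpsd hg hgood hc ν hm hn
    have h2 := mul_le_mul_of_nonneg_left
      (half_sqrt_min_le (Nat.cast_nonneg (α := ℝ) m) (Nat.cast_nonneg (α := ℝ) n)) hE0
    simp only [hu]
    push_cast
    linarith
  have hbdd : BddBelow (Set.range fun n => u n / n) := by
    refine ⟨-(|Real.log b| + lipConst a b δ α * c), ?_⟩
    rintro _ ⟨n, rfl⟩
    rcases Nat.eq_zero_or_pos n with rfl | hn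
    · simp only [Nat.cast_zero, div_zero]
      have := abs_nonneg (Real.log b)
      have : 0 ≤ lipConst a b δ α * c := by positivity
      linarith
    · have hn' : (0 : ℝ) < n := by exact_mod_cast hn
      simp only [hu]
      rw [le_div_iff₀ hn']
      have h1 := meanFreeEnergy_le hJ ha hab hg hgood hc ν n
      have h2 : 0 ≤ 2 * E * √(n : ℝ) := by positivity
      linarith
  have h1 := hsub.tendsto_lim hbdd
  have h2 : Tendsto (fun n : ℕ => √(n : ℝ) / n) atTop (𝓝 0) := by
    have : ∀ n : ℕ, √(n : ℝ) / n = (√(n : ℝ))⁻¹ := fun n => by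
      rw [Real.sqrt_div_self', one_div]
    simp only [this]
    exact (Real.tendsto_sqrt_atTop.comp tendsto_natCast_atTop_atTop).inv_tendsto_atTop
  refine ⟨2 * E * 0 - hsub.lim, ((h2.const_mul (2 * E)).sub h1).congr fun n => ?_⟩
  simp only [hu]
  ring

end Mean

/-! ### Moments of the degrees. -/

section Moments

variable {V : Type*} [Fintype V] [DecidableEq V]

omit [Fintype V] in
lemma incidence_cons {M : ℕ} (y : V × V) (e : Fin M → V × V) (u : V) :
    (incidence (Fin.cons y e : Fin (M + 1) → V × V) u : ℝ) =
      (if y.1 = u ∨ y.2 = u then 1 else 0) + incidence e u := by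
  rw [incidence_eq_sum, incidence_eq_sum, Fin.sum_univ_succ]
  simp

lemma sum_unifEdge_indicator_le [Nonempty V] (u : V) :
    ∑ y : V × V, unifEdge V y * (if y.1 = u ∨ y.2 = u then (1 : ℝ) else 0) ≤
      2 / Fintype.card V := by
  have hN : (0 : ℝ) < Fintype.card V := by exact_mod_cast Fintype.card_pos
  calc _ ≤ ∑ y : V × V, unifEdge V y *
        ((if y.1 = u then (1 : ℝ) else 0) + if y.2 = u then 1 else 0) := by
        refine Finset.sum_le_sum fun y _ => mul_le_mul_of_nonneg_left ?_ (unifEdge_nonneg V y)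
        by_cases h1 : y.1 = u <;> by_cases h2 : y.2 = u <;> simp [h1, h2]
    _ = _ := by
        have h1 : ∑ y : V × V, (if y.1 = u then (1 : ℝ) else 0) = Fintype.card V := by
          rw [Fintype.sum_prod_type_right]; simp
        have h2 : ∑ y : V × V, (if y.2 = u then (1 : ℝ) else 0) = Fintype.card V := by
          rw [Fintype.sum_prod_type]; simp
        simp only [unifEdge, ← Finset.mul_sum, Finset.sum_add_distrib, h1, h2]
        field_simp
        norm_num

lemma edgeMean_incidence [Nonempty V] (M : ℕ) (u : V) {t : ℝ}
    (ht : t = ∑ y : V × V, unifEdge V y * (if y.1 = u ∨ y.2 = u then (1 : ℝ) else 0)) :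
    edgeMean V M (fun e => (incidence e u : ℝ)) = M * t := by
  induction M with
  | zero => simp [edgeMean, incidence]
  | succ M ih =>
    rw [edgeMean_succ']
    simp only [incidence_cons, mul_add, Finset.sum_add_distrib, ← Finset.sum_mul, sum_unifEdge,
      one_mul, ← ht]
    rw [edgeMean_add, edgeMean_const, ih]
    push_cast; ring

/-- The degree is a sum of `M` independent indicators of mean `t`, whose second moment is `M * t +
(M * t) ^ 2 - M * t ^ 2`. -/
lemma edgeMean_incidence_sq [Nonempty V] (M : ℕ) (u : V) {t : ℝ}
    (ht : t = ∑ y : V × V, unifEdge V y * (if y.1 = u ∨ y.2 = u then (1 : ℝ) else 0)) :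
    edgeMean V M (fun e => (incidence e u : ℝ) ^ 2) ≤ M * t + (M * t) ^ 2 := by
  induction M with
  | zero => simp [edgeMean, incidence]
  | succ M ih =>
    rw [edgeMean_succ']
    have h1 : ∀ e : Fin M → V × V, ∑ y, unifEdge V y *
        (incidence (Fin.cons y e : Fin (M + 1) → V × V) u : ℝ) ^ 2 =
        t + 2 * t * incidence e u + (incidence e u : ℝ) ^ 2 := fun e => by
      have h2 : ∀ y : V × V, unifEdge V y *
          (incidence (Fin.cons y e : Fin (M + 1) → V × V) u : ℝ) ^ 2 =
          (unifEdge V y * (if y.1 = u ∨ y.2 = u then (1 : ℝ) else 0)) *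
            (1 + 2 * incidence e u) + unifEdge V y * (incidence e u : ℝ) ^ 2 := fun y => by
        rw [incidence_cons]; split_ifs <;> ring
      simp only [h2, Finset.sum_add_distrib, ← Finset.sum_mul, sum_unifEdge, ← ht]
      ring
    simp only [h1]
    rw [edgeMean_add, edgeMean_add, edgeMean_const_mul, edgeMean_const, edgeMean_incidence M u ht]
    push_cast
    nlinarith [sq_nonneg t]

/-- An upper bound for the second moment of a shifted degree. -/
def degConst (c : ℝ) : ℝ := 8 + 2 * (2 * c + (2 * c) ^ 2)

lemma edgeMean_sq_two_add_incidence_le [Nonempty V] {c : ℝ} (hc : 0 < c) {M : ℕ}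
    (hM : (M : ℝ) ≤ c * Fintype.card V) (u : V) :
    edgeMean V M (fun e => (2 + incidence e u : ℝ) ^ 2) ≤ degConst c := by
  have hN : (0 : ℝ) < Fintype.card V := by exact_mod_cast Fintype.card_pos
  obtain ⟨t, ht⟩ : ∃ t, t = ∑ y : V × V,
      unifEdge V y * (if y.1 = u ∨ y.2 = u then (1 : ℝ) else 0) := ⟨_, rfl⟩
  have ht2 : t ≤ 2 / Fintype.card V := ht ▸ sum_unifEdge_indicator_le u
  have ht0 : 0 ≤ t := ht ▸ Finset.sum_nonneg fun y _ => mul_nonneg (unifEdge_nonneg V y)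
    (by split_ifs <;> norm_num)
  have hMt : (M : ℝ) * t ≤ 2 * c := by
    calc _ ≤ c * Fintype.card V * (2 / Fintype.card V) := by gcongr
      _ = _ := by field_simp
  have h1 := edgeMean_incidence_sq M u ht
  have h2 : edgeMean V M (fun e => (2 + incidence e u : ℝ) ^ 2) ≤
      edgeMean V M (fun e => 8 + 2 * (incidence e u : ℝ) ^ 2) :=
    edgeMean_mono fun e => by nlinarith [sq_nonneg ((incidence e u : ℝ) - 2)]
  rw [edgeMean_add, edgeMean_const, edgeMean_const_mul] at h2
  have h3 : ((M : ℝ) * t) ^ 2 ≤ (2 * c) ^ 2 := pow_le_pow_left₀ (by positivity) hMt 2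
  unfold degConst
  linarith

end Moments

/-! ### The variance of `log Z` is at most linear in `N`. -/

section Variance

open ProbabilityTheory

variable {N : ℕ} [NeZero N]

omit [NeZero N] in
lemma uniformOn_real_singleton (y : Fin N × Fin N) :
    (uniformOn (Set.univ : Set (Fin N × Fin N))).real {y} = unifEdge (Fin N) y := by
  rw [measureReal_def, uniformOn_univ]
  simp [unifEdge, sq]

omit [NeZero N] in
lemma integral_uniformOn (f : Fin N × Fin N → ℝ) :
    ∫ y, f y ∂(uniformOn (Set.univ : Set (Fin N × Fin N))) =
      ∑ y, unifEdge (Fin N) y * f y := by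
  rw [integral_fintype (Integrable.of_finite)]
  simp only [uniformOn_real_singleton, smul_eq_mul]

lemma integral_pi_uniformOn {M : ℕ} (f : (Fin M → Fin N × Fin N) → ℝ) :
    ∫ e, f e ∂(Measure.pi fun _ => uniformOn (Set.univ : Set (Fin N × Fin N))) =
      edgeMean (Fin N) M f := by
  rw [integral_fintype (Integrable.of_finite), edgeMean, Finset.sum_div]
  refine Finset.sum_congr rfl fun e _ => ?_
  rw [measureReal_def, Measure.pi_singleton, ENNReal.toReal_prod]
  simp only [← measureReal_def, uniformOn_real_singleton]
  simp only [unifEdge, Finset.prod_const, Finset.card_univ, Fintype.card_fin, smul_eq_mul]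
  rw [one_div, inv_pow, inv_mul_eq_div]

lemma bddMeas_of_finite {X : Type*} [MeasurableSpace X] [DiscreteMeasurableSpace X] [Fintype X]
    (f : X → ℝ) : BddMeas f :=
  ⟨Measurable.of_discrete, ∑ x, |f x|, fun x =>
    Finset.single_le_sum (f := fun x => |f x|) (fun _ _ => abs_nonneg _) (Finset.mem_univ x)⟩

/-- The variance over the edges of a function whose oscillation under resampling one edge is
controlled by the degrees. -/
lemma variance_edges_le {c C : ℝ} (hc : 0 < c) {M : ℕ} (hM : (M : ℝ) ≤ c * N)
    (f : (Fin M → Fin N × Fin N) → ℝ)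
    (hf : ∀ x m y y', f (Function.update x m y) - C * (2 + incidence x y'.1) ≤
      f (Function.update x m y')) :
    edgeMean (Fin N) M (fun e => (f e - edgeMean (Fin N) M f) ^ 2) ≤
      C ^ 2 * degConst c * (c * N) := by
  have hdeg : 0 ≤ degConst c := by unfold degConst; positivity
  have key := efronStein (μ := uniformOn (Set.univ : Set (Fin N × Fin N)))
    (f := f) (D := fun _ x => ∑ y, unifEdge (Fin N) y * (C ^ 2 * (2 + incidence x y.1 : ℝ) ^ 2))
    (bddMeas_of_finite f) (fun i => bddMeas_of_finite _) fun m x => by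
      -- The oscillation bound is one-sided. Centring at the maximum `y₀` makes it enough: every
      -- deviation lies between zero and `C` times the shifted degree of the resampled edge.
      obtain ⟨y₀, hy₀⟩ := Finite.exists_max fun y => f (Function.update x m y)
      refine ⟨f (Function.update x m y₀), ?_⟩
      rw [integral_uniformOn]
      refine Finset.sum_le_sum fun y _ => mul_le_mul_of_nonneg_left ?_ (unifEdge_nonneg _ y)
      have h1 := hf x m y₀ y
      have h2 := hy₀ y
      rw [← mul_pow, ← neg_sq]
      exact pow_le_pow_left₀ (by linarith) (by linarith) 2
  simp only [integral_pi_uniformOn] at key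
  refine key.trans ?_
  rw [Finset.sum_const, Finset.card_univ, Fintype.card_fin, nsmul_eq_mul]
  have h1 : edgeMean (Fin N) M (fun x =>
      ∑ y, unifEdge (Fin N) y * (C ^ 2 * (2 + incidence x y.1 : ℝ) ^ 2)) ≤ C ^ 2 * degConst c := by
    have h2 : edgeMean (Fin N) M (fun x =>
        ∑ y, unifEdge (Fin N) y * (C ^ 2 * (2 + incidence x y.1 : ℝ) ^ 2)) =
        ∑ y, unifEdge (Fin N) y * (C ^ 2 *
          edgeMean (Fin N) M fun x => (2 + incidence x y.1 : ℝ) ^ 2) := by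
      simp only [← edgeMean_const_mul]
      simp only [edgeMean]
      rw [Finset.sum_comm, Finset.sum_div]
    rw [h2]
    calc _ ≤ ∑ y, unifEdge (Fin N) y * (C ^ 2 * degConst c) := by
          refine Finset.sum_le_sum fun y _ => mul_le_mul_of_nonneg_left
            (mul_le_mul_of_nonneg_left ?_ (sq_nonneg C)) (unifEdge_nonneg _ y)
          exact edgeMean_sq_two_add_incidence_le hc (by rwa [Fintype.card_fin]) y.1
      _ = _ := by rw [← Finset.sum_mul, sum_unifEdge, one_mul]
  calc (M : ℝ) * _ ≤ M * (C ^ 2 * degConst c) := by gcongr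
    _ ≤ (c * N) * (C ^ 2 * degConst c) := by
        gcongr
    _ = _ := by ring

lemma variance_log_graphSum_le {q : ℕ} {J : Fin q → Fin q → ℝ} {a b δ α : ℝ}
    {g : (Fin q → ℝ) → Fin q → ℝ} (hJ : EdgeBounds J δ α) (ha : 0 < a) (hab : a ≤ b)
    (hg : Measurable g) (hgood : ∀ ω, GoodPot J a b (g ω)) {c : ℝ} (hc : 0 < c)
    (ν : Measure (Fin q → ℝ)) [IsProbabilityMeasure ν] :
    Integrable (fun ω => (Real.log (graphSum J ω.1 fun u => g (ω.2 u)) -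
      meanFreeEnergy J ν g c N) ^ 2) (randomGraphLaw c ν N) ∧
    ∫ ω, (Real.log (graphSum J ω.1 fun u => g (ω.2 u)) - meanFreeEnergy J ν g c N) ^ 2
      ∂(randomGraphLaw c ν N) ≤
        lipConst a b δ α ^ 2 * degConst c * (1 + c) * N := by
  set M := ⌊c * (N : ℝ)⌋₊ with hM
  have hMle : (M : ℝ) ≤ c * N := Nat.floor_le (by positivity)
  set C := lipConst a b δ α with hC
  have hC0 : 0 ≤ C := (lipConst_spec hJ ha hab).1
  set P := Measure.pi fun _ : Fin N => ν with hP
  set U := Measure.pi fun _ : Fin M => uniformOn (Set.univ : Set (Fin N × Fin N)) with hU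
  set m := meanFreeEnergy J ν g c N with hm
  set F : (Fin M → Fin N × Fin N) × (Fin N → Fin q → ℝ) → ℝ :=
    fun ω => Real.log (graphSum J ω.1 fun u => g (ω.2 u)) with hF
  have hFe : ∀ e, BddMeas fun x => F (e, x) := fun e =>
    bddMeas_log_graphSum hJ ha hab hg hgood e
  have hFB : BddMeas F := by
    obtain ⟨K, hK⟩ := exists_abs_log_graphSum_le (V := Fin N) hJ ha hab M
    exact ⟨measurable_from_prod_countable_right fun e => (hFe e).meas, K,
      fun ω => hK ω.1 _ fun u => hgood _⟩
  have hlaw : randomGraphLaw c ν N = U.prod P := rfl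
  have hint : Integrable (fun ω => (F ω - m) ^ 2) (U.prod P) :=
    (hFB.sub (.const m)).sq.integrable _
  rw [hlaw]
  refine ⟨hint, ?_⟩
  rw [integral_prod _ hint, integral_pi_uniformOn]
  set G : (Fin M → Fin N × Fin N) → ℝ := fun e => ∫ x, F (e, x) ∂P with hG
  have hmG : m = edgeMean (Fin N) M G := by
    rw [← integral_pi_uniformOn, hG, integral_integral_swap (f := fun e x => F (e, x))
      (hFB.integrable (U.prod P))]
    exact integral_congr_ae (Eventually.of_forall fun x =>
      (integral_pi_uniformOn fun e => F (e, x)).symm)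
  -- Total variance, conditionally on the edges: Efron-Stein is applied to the node potentials for a
  -- fixed graph, and then to the edges for the conditional mean `G`.
  have e1 : ∀ e, ∫ x, (F (e, x) - m) ^ 2 ∂P =
      ∫ x, (F (e, x) - G e) ^ 2 ∂P + (G e - m) ^ 2 := fun e => integral_sub_sq_eq (hFe e) m
  simp only [e1]
  rw [edgeMean_add]
  have hedge : edgeMean (Fin N) M (fun e => (G e - m) ^ 2) ≤ C ^ 2 * degConst c * (c * N) := by
    rw [hmG]
    refine variance_edges_le hc hMle G fun x k y y' => ?_
    have h1 : ∫ h, (F (Function.update x k y, h) - C * (2 + incidence x y'.1)) ∂P ≤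
        ∫ h, F (Function.update x k y', h) ∂P :=
      integral_mono (((hFe _).sub (.const _)).integrable P) ((hFe _).integrable P) fun h =>
        log_graphSum_change_edge hJ ha hab (fun u => hgood _) x k y y'
    rw [integral_sub ((hFe _).integrable P) (integrable_const _)] at h1
    simpa using h1
  have hnode : ∀ e, ∫ x, (F (e, x) - G e) ^ 2 ∂P ≤
      ∑ u, C ^ 2 * (2 + incidence e u : ℝ) ^ 2 := fun e => by
    have key := efronStein (μ := ν) (f := fun x => F (e, x))
      (D := fun u _ => C ^ 2 * (2 + incidence e u : ℝ) ^ 2) (hFe e) (fun i => .const _) fun u x => by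
        refine ⟨F (e, x), ?_⟩
        have hpt : ∀ y, (F (e, Function.update x u y) - F (e, x)) ^ 2 ≤
            C ^ 2 * (2 + incidence e u : ℝ) ^ 2 := fun y => by
          have h1 := log_graphSum_change_node hJ ha hab (h := fun w => g (x w))
            (h' := fun w => g (Function.update x u y w)) (fun w => hgood _) u (hgood _)
            (fun w hw => by simp [hw]) e
          have h2 := log_graphSum_change_node hJ ha hab
            (h := fun w => g (Function.update x u y w)) (h' := fun w => g (x w))
            (fun w => hgood _) u (hgood _) (fun w hw => by simp [hw]) e
          rw [← mul_pow]
          refine sq_le_sq' ?_ ?_ <;> simp only [hF] <;> linarith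
        have hB : BddMeas fun y => (F (e, Function.update x u y) - F (e, x)) ^ 2 :=
          (((hFe e).comp (measurable_update x)).sub (.const _)).sq
        have := integral_mono (hB.integrable ν) (integrable_const _) hpt
        simpa using this
    simpa using key
  have hnode' : edgeMean (Fin N) M (fun e => ∫ x, (F (e, x) - G e) ^ 2 ∂P) ≤
      C ^ 2 * degConst c * N := by
    refine (edgeMean_mono hnode).trans ?_
    have h2 : edgeMean (Fin N) M (fun e => ∑ u, C ^ 2 * (2 + incidence e u : ℝ) ^ 2) =
        ∑ u, C ^ 2 * edgeMean (Fin N) M fun e => (2 + incidence e u : ℝ) ^ 2 := by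
      simp only [← edgeMean_const_mul]
      simp only [edgeMean]
      rw [Finset.sum_comm, Finset.sum_div]
    rw [h2]
    calc _ ≤ ∑ _u : Fin N, C ^ 2 * degConst c := by
          refine Finset.sum_le_sum fun u _ => mul_le_mul_of_nonneg_left ?_ (sq_nonneg C)
          exact edgeMean_sq_two_add_incidence_le hc (by rwa [Fintype.card_fin]) u
      _ = _ := by simp [mul_comm]
  linarith

end Variance

/-! ### Chebyshev's inequality and the three models. -/

section Main

variable {q : ℕ} {J : Fin q → Fin q → ℝ} {a b : ℝ}

lemma exists_edgeBounds {α : ℝ} (hJ : ∀ i j, 0 ≤ J i j) (hα : ∀ i j, J i j ≤ α)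
    (hs : ∃ i, IsSoft J i) : ∃ δ, EdgeBounds J δ α := by
  classical
  obtain ⟨i₀, hi₀⟩ := hs
  have : Nonempty (Fin q × Fin q) := ⟨(i₀, i₀)⟩
  have hα0 : 0 < α := (hi₀ i₀).1.trans_le (hα _ _)
  -- The constant `δ` is the least interaction of a soft spin with any spin; `α` is a harmless
  -- filler at the spins that are not soft.
  obtain ⟨p, hp⟩ := Finite.exists_min fun p : Fin q × Fin q =>
    if IsSoft J p.1 then min (J p.1 p.2) (J p.2 p.1) else α
  have hmin : ∀ i j, IsSoft J i → (if IsSoft J p.1 then min (J p.1 p.2) (J p.2 p.1) else α) ≤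
      min (J i j) (J j i) := fun i j hi => by simpa [hi] using hp (i, j)
  refine ⟨_, ⟨?_, ?_, hJ, hα, fun i j hi => (hmin i j hi).trans (min_le_left _ _),
    fun i j hi => (hmin i j hi).trans (min_le_right _ _)⟩⟩
  · split_ifs with h
    exacts [lt_min (h _).1 (h _).2, hα0]
  · exact (hmin i₀ i₀ hi₀).trans ((min_le_left _ _).trans (hα _ _))

lemma measurableSet_goodPot : MeasurableSet {h : Fin q → ℝ | GoodPot J a b h} := by
  classical
  have h1 : MeasurableSet {h : Fin q → ℝ | ∀ i, 0 ≤ h i} := by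
    rw [Set.ofPred_forall]
    exact MeasurableSet.iInter fun i => measurableSet_le measurable_const (measurable_pi_apply i)
  have h2 : MeasurableSet {h : Fin q → ℝ | a ≤ ∑ i with IsSoft J i, h i} :=
    measurableSet_le measurable_const (Finset.measurable_sum _ fun i _ => measurable_pi_apply i)
  have h3 : MeasurableSet {h : Fin q → ℝ | ∑ i, h i ≤ b} :=
    measurableSet_le (Finset.measurable_sum _ fun i _ => measurable_pi_apply i) measurable_const
  convert h1.inter (h2.inter h3) using 1
  ext h
  simp [GoodPot]

/-- Node potentials which are almost surely good agree almost surely with everywhere good ones. -/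
lemma exists_good_modification (ν : Measure (Fin q → ℝ)) [IsProbabilityMeasure ν]
    (h : ∀ᵐ x ∂ν, GoodPot J a b x) :
    ∃ g : (Fin q → ℝ) → Fin q → ℝ, Measurable g ∧ (∀ x, GoodPot J a b (g x)) ∧
      ∀ᵐ x ∂ν, g x = x := by
  classical
  obtain ⟨x₀, hx₀⟩ := h.exists
  refine ⟨fun x => if GoodPot J a b x then x else x₀,
    Measurable.ite measurableSet_goodPot measurable_id measurable_const, fun x => ?_, ?_⟩
  · dsimp only
    split_ifs with hx
    exacts [hx, hx₀]
  · filter_upwards [h] with x hx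
    simp [hx]

lemma ae_randomGraphLaw {c : ℝ} {ν : Measure (Fin q → ℝ)} [IsProbabilityMeasure ν]
    {N : ℕ} {p : (Fin q → ℝ) → Prop} (hp : ∀ᵐ x ∂ν, p x) :
    ∀ᵐ ω ∂(randomGraphLaw c ν N), ∀ u, p (ω.2 u) := by
  have h : ∀ᵐ x ∂(Measure.pi fun _ : Fin N => ν), ∀ u, p (x u) :=
    ae_all_iff.2 fun u => (Measure.quasiMeasurePreserving_eval (fun _ : Fin N => ν) u).ae hp
  exact Measure.quasiMeasurePreserving_snd.ae h

lemma rightConverging_of_posSemidef {c : ℝ} (hc : 0 < c) {α : ℝ} (ν : Measure (Fin q → ℝ))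
    [IsProbabilityMeasure ν] (hJ : ∀ i j, 0 ≤ J i j) (hα : ∀ i j, J i j ≤ α)
    (hpsd : (Matrix.of fun i j => α - J i j).PosSemidef) (hν : NodeAssumption ν J) :
    RightConverging c ν J := by
  obtain ⟨a, b, ha, hgood⟩ := hν
  replace hgood : ∀ᵐ x ∂ν, GoodPot J a b x := hgood
  obtain ⟨g, hg, hgg, hgν⟩ := exists_good_modification ν hgood
  have hab : a ≤ b := (hgg 0).lower_le_upper
  obtain ⟨s, hs, -⟩ := (hgg 0).exists_soft ha
  obtain ⟨δ, hE⟩ := exists_edgeBounds hJ hα ⟨s, hs⟩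
  obtain ⟨z, hz⟩ := exists_tendsto_meanFreeEnergy hE ha hab hpsd hg hgg hc ν
  refine ⟨z, fun ε hε => ?_⟩
  set K := lipConst a b δ α ^ 2 * degConst c * (1 + c) with hK
  have hlim : Tendsto (fun N : ℕ => ENNReal.ofReal (4 * K / ε ^ 2 / N)) atTop (𝓝 0) := by
    rw [← ENNReal.ofReal_zero]
    exact ENNReal.tendsto_ofReal (tendsto_const_nhds.div_atTop tendsto_natCast_atTop_atTop)
  refine tendsto_of_tendsto_of_tendsto_of_le_of_le' tendsto_const_nhds hlim
    (Eventually.of_forall fun _ => zero_le) ?_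
  filter_upwards [eventually_gt_atTop 0, (Metric.tendsto_nhds.1 hz) (ε / 2) (half_pos hε)]
    with N hN hNz
  have : NeZero N := ⟨hN.ne'⟩
  have hN' : (0 : ℝ) < N := by exact_mod_cast hN
  have : IsProbabilityMeasure (randomGraphLaw c ν N) := by unfold randomGraphLaw; infer_instance
  obtain ⟨hint, hvar⟩ := variance_log_graphSum_le (N := N) hE ha hab hg hgg hc ν
  set m := meanFreeEnergy J ν g c N with hm
  -- Half of the deviation `ε` is left to the distance of the normalized mean from `z`, the other
  -- half to the fluctuation of `log Z`.
  set t : ℝ := (ε * N / 2) ^ 2 with ht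
  have ht0 : 0 < t := by positivity
  set A := {ω : (Fin ⌊c * (N : ℝ)⌋₊ → Fin N × Fin N) × (Fin N → Fin q → ℝ) |
    t ≤ (Real.log (graphSum J ω.1 fun u => g (ω.2 u)) - m) ^ 2} with hA
  have hcheb : (randomGraphLaw c ν N).real A ≤ 4 * K / ε ^ 2 / N := by
    have h1 := mul_meas_ge_le_integral_of_nonneg (Eventually.of_forall fun ω => sq_nonneg _)
      hint t
    have h2 : t * (randomGraphLaw c ν N).real A ≤ K * N := h1.trans hvar
    rw [← le_div_iff₀' ht0] at h2
    refine h2.trans (Eq.le ?_)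
    rw [ht]; field_simp; ring
  refine le_trans ?_ ((ENNReal.le_ofReal_iff_toReal_le (measure_ne_top _ _) ?_).2 hcheb)
  -- Almost surely `g` does not alter the potentials, so `Z` is positive and the event `Z = 0`
  -- contributes nothing.
  · refine measure_mono_ae ?_
    filter_upwards [ae_randomGraphLaw (c := c) (N := N) hgν] with ω hω hbad
    have hω' : (fun u => g (ω.2 u)) = ω.2 := funext hω
    have hpos : 0 < graphSum J ω.1 ω.2 := by
      rw [← hω']; exact graphSum_pos hE ha (fun u => hgg _) _
    change t ≤ (Real.log (graphSum J ω.1 fun u => g (ω.2 u)) - m) ^ 2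
    rw [hω']
    rcases hbad with h0 | hdev
    · exact absurd h0 hpos.ne'
    · change ε < |(N : ℝ)⁻¹ * Real.log (graphSum J ω.1 ω.2) - z| at hdev
      rw [Real.dist_eq] at hNz
      set L := Real.log (graphSum J ω.1 ω.2)
      have h3 : (N : ℝ)⁻¹ * L - z = (L - m) / N + (m / N - z) := by field_simp; ring
      have h4 := abs_add_le ((L - m) / N) (m / N - z)
      rw [← h3] at h4
      have h5 : ε / 2 ≤ |L - m| / N := by
        rw [abs_div, abs_of_pos hN'] at h4; linarith
      rw [le_div_iff₀ hN'] at h5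
      rw [ht, ← sq_abs (L - m)]
      exact pow_le_pow_left₀ (by positivity) (by linarith) 2
  · have h1 : 0 ≤ K := by unfold K degConst; positivity
    positivity

lemma nodeAssumption_dirac {h : Fin q → ℝ} (hh : ∀ i, 0 ≤ h i) {s : Fin q} (hs : IsSoft J s)
    (hpos : 0 < h s) : NodeAssumption (Measure.dirac h) J := by
  classical
  refine ⟨h s, ∑ i, h i, hpos, ?_⟩
  rw [ae_dirac_eq]
  refine ⟨hh, ?_, le_rfl⟩
  exact Finset.single_le_sum (f := h) (fun i _ => hh i) (Finset.mem_filter.2 ⟨Finset.mem_univ s, hs⟩)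

/-- Covers models which penalize only equal spins at the two ends of an edge: `α - J` is then a
nonnegative diagonal matrix. -/
lemma rightConverging_of_diagonal {c : ℝ} (hc : 0 < c) {α : ℝ} {h d : Fin q → ℝ}
    (hJ : ∀ i j, 0 ≤ J i j) (hd : ∀ i, 0 ≤ d i)
    (hJd : ∀ i j, J i j = if i = j then α - d i else α)
    (hh : ∀ i, 0 ≤ h i) {s : Fin q} (hs : IsSoft J s) (hpos : 0 < h s) :
    RightConverging c (Measure.dirac h) J := by
  have hdiag : (Matrix.of fun i j => α - J i j) = Matrix.diagonal d := by
    ext i j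
    rw [Matrix.of_apply, hJd, Matrix.diagonal_apply]
    split_ifs <;> ring
  refine rightConverging_of_posSemidef hc _ hJ (α := α) (fun i j => ?_) ?_
    (nodeAssumption_dirac hh hs hpos)
  · rw [hJd]
    split_ifs
    · linarith [hd i]
    · exact le_rfl
  · rw [hdiag]
    exact Matrix.PosSemidef.diagonal hd

end Main

end

theorem theorem2 (c : ℝ) (hc : 0 < c) :
    (∀ (q : ℕ) (J : Fin q → Fin q → ℝ) (ν : Measure (Fin q → ℝ)) [IsProbabilityMeasure ν],
      (∀ i j, 0 ≤ J i j) →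
      (∃ i, ∀ j, 0 < J i j) →
      (∃ α : ℝ, (∀ i j, J i j ≤ α) ∧ (Matrix.of fun i j => α - J i j).PosSemidef) →
      NodeAssumption ν J →
      RightConverging c ν J) ∧
    -- independent sets with activity `lam`
    (∀ lam : ℝ, 0 < lam → RightConverging c (Measure.dirac ![1, lam]) hardCoreEdge) ∧
    -- the anti-ferromagnetic Potts model
    (∀ (q : ℕ) (β : ℝ), 1 ≤ q → 0 < β →
      RightConverging c (Measure.dirac fun _ => 1) (pottsEdge q β)) ∧
    -- the anti-ferromagnetic Ising model with external magnetization `h`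
    (∀ β h : ℝ, β < 0 → 0 ≤ h → RightConverging c (Measure.dirac ![1, h]) (isingEdge β)) := by
  refine ⟨fun q J ν _ hJ _ ⟨α, hα, hpsd⟩ hν => rightConverging_of_posSemidef hc ν hJ hα hpsd hν,
    fun lam hlam => ?_, fun q β hq hβ => ?_, fun β h hβ hh => ?_⟩
  · refine rightConverging_of_diagonal hc (α := 1) (d := ![0, 1]) (s := 0) (fun i j => ?_)
      (fun i => ?_) (fun i j => ?_) (fun i => ?_) (fun j => ?_) ?_
    · unfold hardCoreEdge; split_ifs <;> norm_num
    · fin_cases i <;> simp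
    · fin_cases i <;> fin_cases j <;> simp [hardCoreEdge]
    · fin_cases i <;> simp [hlam.le]
    · simp [hardCoreEdge]
    · simp
  · have hpos : ∀ i j, 0 < pottsEdge q β i j := fun i j => by
      unfold pottsEdge; split_ifs <;> positivity
    refine rightConverging_of_diagonal hc (α := 1) (d := fun _ => 1 - Real.exp (-β)) (s := ⟨0, hq⟩)
      (fun i j => (hpos i j).le) (fun i => ?_) (fun i j => ?_)
      (fun i => zero_le_one) (fun j => ⟨hpos _ _, hpos _ _⟩) one_pos
    · rw [sub_nonneg, Real.exp_le_one_iff]; linarith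
    · unfold pottsEdge; split_ifs <;> ring
  · have hpos : ∀ i j, 0 < isingEdge β i j := fun i j => by
      unfold isingEdge; split_ifs <;> positivity
    -- As `β < 0`, the maximum of `J` is `exp (-β)`. The soft spin `0` has weight `1`, so the case
    -- `h = 0` is included.
    refine rightConverging_of_diagonal hc (α := Real.exp (-β))
      (d := fun _ => Real.exp (-β) - Real.exp β) (s := 0)
      (fun i j => (hpos i j).le) (fun i => ?_) (fun i j => ?_)
      (fun i => ?_) (fun j => ⟨hpos _ _, hpos _ _⟩) (by simp)
    · rw [sub_nonneg, Real.exp_le_exp]; linarith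
    · unfold isingEdge; split_ifs <;> ring
    · fin_cases i <;> simp [hh]
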